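/- A commutative DG ring (CDG ring) is a graded ring $A=\bigoplus_{i\le 0}A^i$ which is strongly commutative, i.e. $b\cdot a=(-1)^{ij}\,a\cdot b$ for all $a\in A^i$, $b\in A^j$, and $a\cdot a=0$ for $a\in A^i$ with $i$ odd, equipped with a differential $\mathrm d_A$ of degree $1$ satisfying $\mathrm d_A\circ \mathrm d_A=0$ and $\mathrm d_A(a\cdot b)=\mathrm d_A(a)\cdot b+(-1)^i\,a\cdot \mathrm d_A(b)$ for $a\in A^i$, $b\in A^j$. Homomorphisms of CDG rings are the degree-preserving unital ring homomorphisms commuting with the differentials; such a homomorphism $f$ is a quasi-isomorphism if $\mathrm H^i(f)$ is bijective for all $i$. A divided power structure on a CDG ring $B$ consists of functions $\gamma^k:B^i\to B^{ki}$, for all integers $k\ge 0$ and all even $i\le -2$, such that for every $a\in B^i$ and all $k,l\ge 0$ one has $\gamma^0(a)=1$, $\gamma^1(a)=a$, $\gamma^k(a)\cdot\gamma^l(a)=\binom{k+l}{l}\cdot\gamma^{k+l}(a)$, and, for $k\ge 1$, $\mathrm d_B(\gamma^k(a))=\mathrm d_B(a)\cdot\gamma^{k-1}(a)$ (no further identities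 are required). Theorem 1. Let $f:A\to B$ be a quasi-isomorphism of CDG rings, and assume that $B$ admits a divided power structure. Then there exists a CDG ring $\tilde B$, with CDG ring homomorphisms $e:A\to\tilde B$, $p:\tilde B\to A$ and $\tilde f:\tilde B\to B$, such that $p\circ e=\mathrm{id}_A$, $\tilde f\circ e=f$, and $\tilde f$ is a surjective quasi-isomorphism. -/

import Mathlib

universe u

/-- A commutative differential graded ring (CDG ring): a ring `A = ⨁ A^i`, graded in nonpositive
degrees, strongly commutative, with a differential `d` of degree `1` that satisfies the graded
Leibniz rule. -/
structure CDGRing where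
  /-- The underlying ring. -/
  carrier : Type u
  [ring : Ring carrier]
  /-- The homogeneous components `A^i`. -/
  gr : ℤ → AddSubgroup carrier
  [graded : GradedRing gr]
  /-- The grading is nonpositive. -/
  gr_eq_bot : ∀ i : ℤ, 0 < i → gr i = ⊥
  /-- `b * a = (-1)^(i*j) * a * b` for `a ∈ A^i` and `b ∈ A^j`. -/
  graded_comm : ∀ {i j : ℤ} {a b : carrier}, a ∈ gr i → b ∈ gr j →
    b * a = (i * j).negOnePow • (a * b)
  /-- `a * a = 0` for `a` of odd degree. -/
  odd_sq : ∀ {i : ℤ} {a : carrier}, Odd i → a ∈ gr i → a * a = 0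
  /-- The differential. -/
  d : carrier →+ carrier
  d_mem : ∀ {i : ℤ} {a : carrier}, a ∈ gr i → d a ∈ gr (i + 1)
  d_d : ∀ a : carrier, d (d a) = 0
  leibniz : ∀ {i j : ℤ} {a b : carrier}, a ∈ gr i → b ∈ gr j →
    d (a * b) = d a * b + i.negOnePow • (a * d b)

namespace CDGRing

attribute [instance] CDGRing.ring CDGRing.graded

/-- A homomorphism of CDG rings: a (unital) ring homomorphism that respects the gradings and
commutes with the differentials. -/
structure Hom (A B : CDGRing.{u}) extends GradedRingHom A.gr B.gr where
  map_d : ∀ a : A.carrier, toFun (A.d a) = B.d (toFun a)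

namespace Hom

instance (A B : CDGRing.{u}) : CoeFun (Hom A B) (fun _ => A.carrier → B.carrier) :=
  ⟨fun f => f.toFun⟩

theorem ext {A B : CDGRing.{u}} {f g : Hom A B} (h : ∀ a : A.carrier, f a = g a) : f = g := by
  obtain ⟨f, hf⟩ := f
  obtain ⟨g, hg⟩ := g
  have : f = g := GradedRingHom.ext h
  subst this
  rfl

/-- The identity homomorphism. -/
def id (A : CDGRing.{u}) : Hom A A where
  toGradedRingHom := GradedRingHom.id A.gr
  map_d _ := rfl

/-- Composition of homomorphisms, `g ∘ f`. -/
def comp {A B C : CDGRing.{u}} (g : Hom B C) (f : Hom A B) : Hom A C where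
  toGradedRingHom := g.toGradedRingHom.comp f.toGradedRingHom
  map_d a := (congrArg g (f.map_d a)).trans (g.map_d (f a))

@[simp] theorem id_apply (A : CDGRing.{u}) (a : A.carrier) : Hom.id A a = a := rfl

@[simp] theorem comp_apply {A B C : CDGRing.{u}} (g : Hom B C) (f : Hom A B) (a : A.carrier) :
    g.comp f a = g (f a) := rfl

end Hom

/-- The degree `i` cocycles `Z^i(A)`. -/
def cocycles (A : CDGRing.{u}) (i : ℤ) : AddSubgroup A.carrier := A.gr i ⊓ A.d.ker

/-- The degree `i` coboundaries `B^i(A) = d(A^(i-1))`. -/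
def coboundaries (A : CDGRing.{u}) (i : ℤ) : AddSubgroup A.carrier := (A.gr (i - 1)).map A.d

theorem coboundaries_le_cocycles (A : CDGRing.{u}) (i : ℤ) :
    A.coboundaries i ≤ A.cocycles i := by
  rintro _ ⟨a, ha, rfl⟩
  refine ⟨?_, A.d_d a⟩
  have h := A.d_mem ha
  rwa [sub_add_cancel] at h

/-- The cohomology `H^i(A) = Z^i(A) / B^i(A)`. -/
abbrev cohomology (A : CDGRing.{u}) (i : ℤ) : Type u :=
  A.cocycles i ⧸ (A.coboundaries i).addSubgroupOf (A.cocycles i)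

namespace Hom

variable {A B : CDGRing.{u}}

theorem map_mem_cocycles (f : Hom A B) {i : ℤ} {a : A.carrier} (ha : a ∈ A.cocycles i) :
    f a ∈ B.cocycles i := by
  refine ⟨f.map_mem ha.1, ?_⟩
  have h : A.d a = 0 := ha.2
  change B.d (f a) = 0
  rw [← f.map_d, h]
  exact f.map_zero'

theorem map_mem_coboundaries (f : Hom A B) {i : ℤ} {a : A.carrier}
    (ha : a ∈ A.coboundaries i) : f a ∈ B.coboundaries i := by
  obtain ⟨x, hx, rfl⟩ := ha
  exact ⟨f x, f.map_mem hx, (f.map_d x).symm⟩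

/-- The homomorphism `Z^i(f) : Z^i(A) → Z^i(B)`. -/
def cocyclesMap (f : Hom A B) (i : ℤ) : A.cocycles i →+ B.cocycles i where
  toFun a := ⟨f a, f.map_mem_cocycles a.2⟩
  map_zero' := Subtype.ext f.map_zero'
  map_add' a b := Subtype.ext (f.map_add' a b)

/-- The homomorphism `H^i(f) : H^i(A) → H^i(B)`. -/
def cohomologyMap (f : Hom A B) (i : ℤ) : A.cohomology i →+ B.cohomology i :=
  QuotientAddGroup.map _ _ (f.cocyclesMap i) fun _ ha => f.map_mem_coboundaries ha

/-- `f` is a quasi-isomorphism if `H^i(f)` is bijective for every `i`. -/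
def IsQuasiIso (f : Hom A B) : Prop := ∀ i : ℤ, Function.Bijective (f.cohomologyMap i)

end Hom

/-- A divided power structure on a CDG ring `A`: functions `γ^k : A^i → A^(k*i)` for all `k ≥ 0`
and all even `i ≤ -2`, satisfying the conditions below. (Some authors require further identities,
e.g. for `γ^k(a + b)`; a divided power structure in their sense is in particular one in this
sense.) -/
structure PDStructure (A : CDGRing.{u}) where
  /-- The functions `γ^k : A^i → A^(k*i)`, for even `i ≤ -2`. -/
  γ : ∀ (k : ℕ) {i : ℤ}, Even i → i ≤ -2 → A.gr i → A.gr (k * i)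
  γ_zero : ∀ {i : ℤ} (he : Even i) (hi : i ≤ -2) (a : A.gr i), (γ 0 he hi a : A.carrier) = 1
  γ_one : ∀ {i : ℤ} (he : Even i) (hi : i ≤ -2) (a : A.gr i), (γ 1 he hi a : A.carrier) = a
  γ_mul : ∀ {i : ℤ} (he : Even i) (hi : i ≤ -2) (a : A.gr i) (k l : ℕ),
    (γ k he hi a : A.carrier) * (γ l he hi a : A.carrier) =
      (k + l).choose l • (γ (k + l) he hi a : A.carrier)
  d_γ : ∀ {i : ℤ} (he : Even i) (hi : i ≤ -2) (a : A.gr i) (k : ℕ), 1 ≤ k →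
    A.d (γ k he hi a : A.carrier) = A.d (a : A.carrier) * (γ (k - 1) he hi a : A.carrier)

end CDGRing

/-! The ring `A` is enlarged by contractible pieces until the map to `B` becomes onto. For every
homogeneous `b` of degree `i ≤ -1` in `B`, adjoin a small CDG ring `K b` generated by `x` of degree
`i` and `d x`. If `i` is odd, it has the ℤ-basis `(d x)^p x^e` with `e ∈ {0, 1}`. If `i` is even,
ordinary powers would not do, because `d (x^n) = n x^(n-1) d x` leaves torsion in cohomology. With
divided powers every coefficient of `d` is 0 or 1, so `K b` contracts to `ℤ` in both cases. The
divided power structure on `B` is what allows `x ↦ b` to extend to `K b → B`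
(`Model.exists_family`).

The ring sought is the coproduct of `A` and all `K b`; `e` is the inclusion of `A`, and `p` sends
every `K b` to `ℤ` by its augmentation. The map to `B` is onto in degrees `≤ -1` by construction,
and in degree 0 because `H^0(f)` is onto. It is a quasi-isomorphism once `x - e (p x)` is a
coboundary for every cocycle `x` (`coprod.sub_retraction`). An element involves only finitely many
`K b` (`coprod.exists_kill`), and these can be killed one at a time, each time changing a cocycle by
a coboundary, through the contraction of `K b` (`coprod.sub_kill_singleton`).

No infinite tensor product is formed. The coproduct consists of the values of formal expressions in
all CDG rings under `A` and the `K b`, and only its universal property is used. The one explicit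
tensor product is `R ⊗ K` for a single model (`Model.extend`), where the homotopy is given by a
formula. -/

/-- A family of subgroups indexed by `ℤ` that generates the group and admits projections is a
decomposition. -/
@[reducible]
noncomputable def decompositionOfProj {M : Type*} [AddCommGroup M] (gr : ℤ → AddSubgroup M)
    (π : ℤ → M →+ M) (h_same : ∀ i, ∀ x ∈ gr i, π i x = x)
    (h_ne : ∀ i j, i ≠ j → ∀ x ∈ gr j, π i x = 0)
    (h_span : ∀ x, x ∈ AddSubgroup.closure (⋃ i, (gr i : Set M))) :
    DirectSum.Decomposition gr := by
  refine DirectSum.IsInternal.chooseDecomposition gr ⟨?_, ?_⟩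
  -- The projections read off the coordinates of a direct sum element from its image, which gives
  -- injectivity.
  · have key : ∀ (y : DirectSum ℤ fun i => gr i) (j : ℤ),
        π j (DirectSum.coeAddMonoidHom gr y) = y j := by
      intro y j
      induction y using DirectSum.induction_on with
      | zero => simp
      | of i x =>
        rw [DirectSum.coeAddMonoidHom_of]
        by_cases h : j = i
        · subst h
          rw [h_same _ _ x.2, DirectSum.of_eq_same]
        · rw [h_ne _ _ h _ x.2, DirectSum.of_eq_of_ne _ _ _ h]
          rfl
      | add x y hx hy => simp [hx, hy]
    intro x y hxy
    ext j
    rw [← key x j, ← key y j, hxy]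
  · intro x
    have : AddSubgroup.closure (⋃ i, (gr i : Set M)) ≤ (DirectSum.coeAddMonoidHom gr).range := by
      rw [AddSubgroup.closure_le]
      intro y hy
      obtain ⟨i, hi⟩ := Set.mem_iUnion.1 hy
      exact ⟨DirectSum.of _ i ⟨y, hi⟩, by simp⟩
    exact this (h_span x)

/-! ### Homogeneous components and the grading involution -/

namespace CDGRing

namespace Hom

variable {A B C : CDGRing.{u}}

theorem map_mem_gr (f : Hom A B) {i : ℤ} {a : A.carrier} (h : a ∈ A.gr i) : f a ∈ B.gr i :=
  f.map_mem h
theorem map_zero (f : Hom A B) : f 0 = 0 := f.map_zero'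
theorem map_one (f : Hom A B) : f 1 = 1 := f.map_one'
theorem map_add (f : Hom A B) (a b : A.carrier) : f (a + b) = f a + f b := f.map_add' a b
theorem map_mul (f : Hom A B) (a b : A.carrier) : f (a * b) = f a * f b := f.map_mul' a b
theorem map_neg (f : Hom A B) (a : A.carrier) : f (-a) = -f a :=
  _root_.map_neg f.toRingHom a
theorem map_sub (f : Hom A B) (a b : A.carrier) : f (a - b) = f a - f b :=
  _root_.map_sub f.toRingHom a b
theorem map_zsmul (f : Hom A B) (n : ℤ) (a : A.carrier) : f (n • a) = n • f a :=
  _root_.map_zsmul f.toRingHom n a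

end Hom

variable (A : CDGRing.{u})

/-- The projection to the homogeneous component of degree `i`. -/
noncomputable def proj (i : ℤ) : A.carrier →+ A.carrier := GradedRing.proj A.gr i

variable {A}

theorem proj_mem (i : ℤ) (a : A.carrier) : A.proj i a ∈ A.gr i := by
  rw [proj, GradedRing.proj_apply]
  exact SetLike.coe_mem _

theorem proj_same {i : ℤ} {a : A.carrier} (h : a ∈ A.gr i) : A.proj i a = a := by
  rw [proj, GradedRing.proj_apply, DirectSum.decompose_of_mem_same _ h]

theorem proj_ne {i j : ℤ} {a : A.carrier} (h : a ∈ A.gr j) (hij : i ≠ j) : A.proj i a = 0 := by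
  rw [proj, GradedRing.proj_apply, DirectSum.decompose_of_mem_ne _ h hij.symm]

theorem hom_induction {p : A.carrier → Prop} (zero : p 0)
    (hom : ∀ (i : ℤ) (a : A.carrier), a ∈ A.gr i → p a)
    (add : ∀ a b, p a → p b → p (a + b)) (a : A.carrier) : p a :=
  DirectSum.Decomposition.inductionOn A.gr zero (fun m => hom _ _ m.2) add a

theorem Hom.map_proj {B : CDGRing.{u}} (f : Hom A B) (i : ℤ) (a : A.carrier) :
    f (A.proj i a) = B.proj i (f a) := by
  induction a using hom_induction with
  | zero => simp only [_root_.map_zero, Hom.map_zero]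
  | hom j a ha =>
    by_cases h : i = j
    · subst h
      rw [proj_same ha, proj_same (f.map_mem_gr ha)]
    · rw [proj_ne ha h, proj_ne (f.map_mem_gr ha) h, Hom.map_zero]
  | add a b ha hb => simp only [_root_.map_add, Hom.map_add, ha, hb]

theorem proj_d (i : ℤ) (a : A.carrier) : A.proj i (A.d a) = A.d (A.proj (i - 1) a) := by
  induction a using hom_induction with
  | zero => simp only [_root_.map_zero]
  | hom j a ha =>
    by_cases h : i = j + 1
    · subst h
      rw [proj_same (A.d_mem ha), add_sub_cancel_right, proj_same ha]
    · rw [proj_ne (A.d_mem ha) h, proj_ne ha (by omega), _root_.map_zero]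
  | add a b ha hb => simp only [_root_.map_add, ha, hb]

theorem one_mem_gr : (1 : A.carrier) ∈ A.gr 0 := SetLike.GradedOne.one_mem

theorem mul_mem_gr {i j : ℤ} {a b : A.carrier} (ha : a ∈ A.gr i) (hb : b ∈ A.gr j) :
    a * b ∈ A.gr (i + j) := SetLike.GradedMul.mul_mem ha hb

theorem d_one : A.d 1 = 0 := by
  have h := A.leibniz (one_mem_gr (A := A)) (one_mem_gr (A := A))
  simp only [mul_one, one_mul, Int.negOnePow_zero, one_smul] at h
  exact left_eq_add.1 h

/-- The elements outside of `s` have zero component. -/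
theorem exists_support (a : A.carrier) : ∃ s : Finset ℤ, ∀ i ∉ s, A.proj i a = 0 := by
  classical
  induction a using hom_induction with
  | zero => exact ⟨∅, fun i _ => _root_.map_zero _⟩
  | hom j a ha => exact ⟨{j}, fun i hi => proj_ne ha (by simpa using hi)⟩
  | add a b ha hb =>
    obtain ⟨s, hs⟩ := ha
    obtain ⟨t, ht⟩ := hb
    refine ⟨s ∪ t, fun i hi => ?_⟩
    rw [Finset.mem_union, not_or] at hi
    rw [_root_.map_add, hs i hi.1, ht i hi.2, add_zero]

theorem sum_proj {s : Finset ℤ} {a : A.carrier} (hs : ∀ i ∉ s, A.proj i a = 0) :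
    ∑ i ∈ s, A.proj i a = a := by
  classical
  conv_rhs => rw [← DirectSum.sum_support_decompose A.gr a]
  symm
  apply Finset.sum_subset_zero_on_sdiff
  · intro i hi
    by_contra h
    have := hs i h
    rw [DFinsupp.mem_support_iff] at hi
    apply hi
    ext
    exact this
  · intro i hi
    rw [Finset.mem_sdiff, DFinsupp.mem_support_iff, not_not] at hi
    rw [proj, GradedRing.proj_apply, hi.2]
    rfl
  · intro i _
    rfl

theorem proj_mul_eq_zero {s t : Finset ℤ} {a b : A.carrier}
    (hs : ∀ i ∉ s, A.proj i a = 0)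
    (ht : ∀ i ∉ t, A.proj i b = 0) {i : ℤ}
    (hi : i ∉ Finset.image₂ (· + ·) s t) : A.proj i (a * b) = 0 := by
  rw [← sum_proj hs, ← sum_proj ht, Finset.sum_mul_sum, _root_.map_sum]
  refine Finset.sum_eq_zero fun j hj => ?_
  rw [_root_.map_sum]
  refine Finset.sum_eq_zero fun k hk => ?_
  refine proj_ne (mul_mem_gr (proj_mem j a) (proj_mem k b)) ?_
  rintro rfl
  exact hi (Finset.mem_image₂_of_mem hj hk)

variable (A) in
/-- The grading involution as an additive map. -/
noncomputable def involAdd : A.carrier →+ A.carrier :=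
  (DirectSum.toAddMonoid fun i : ℤ =>
      (DistribSMul.toAddMonoidHom A.carrier i.negOnePow).comp (A.gr i).subtype).comp
    (DirectSum.decomposeAddEquiv A.gr).toAddMonoidHom

theorem involAdd_of_mem {i : ℤ} {a : A.carrier} (h : a ∈ A.gr i) :
    A.involAdd a = i.negOnePow • a := by
  lift a to A.gr i using h
  simp only [involAdd, AddMonoidHom.comp_apply, AddEquiv.coe_toAddMonoidHom,
    DirectSum.decomposeAddEquiv_apply, DirectSum.decompose_coe, DirectSum.toAddMonoid_of]
  rfl

variable (A) in
/-- The grading involution, `a ↦ (-1)^i a` for `a` of degree `i`. -/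
noncomputable def invol : A.carrier →+* A.carrier where
  toFun := A.involAdd
  map_zero' := _root_.map_zero _
  map_add' := _root_.map_add _
  map_one' := by simp [involAdd_of_mem one_mem_gr]
  map_mul' a b := by
    induction a using hom_induction with
    | zero => simp
    | hom i a ha =>
      induction b using hom_induction with
      | zero => simp
      | hom j b hb =>
        rw [involAdd_of_mem ha, involAdd_of_mem hb, involAdd_of_mem (mul_mem_gr ha hb),
          Int.negOnePow_add, smul_mul_smul_comm]
      | add b c hb hc => simp only [mul_add, _root_.map_add, hb, hc]
    | add a c ha hc => simp only [add_mul, _root_.map_add, ha, hc]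

theorem invol_of_mem {i : ℤ} {a : A.carrier} (h : a ∈ A.gr i) :
    A.invol a = i.negOnePow • a := involAdd_of_mem h

theorem invol_mem {i : ℤ} {a : A.carrier} (h : a ∈ A.gr i) : A.invol a ∈ A.gr i := by
  rw [invol_of_mem h, Units.smul_def]
  exact zsmul_mem h _

@[simp]
theorem invol_invol (a : A.carrier) : A.invol (A.invol a) = a := by
  induction a using hom_induction with
  | zero => simp
  | hom i a ha =>
    rw [invol_of_mem (invol_mem ha), invol_of_mem ha, smul_smul, Int.units_mul_self, one_smul]
  | add a b ha hb => simp only [_root_.map_add, ha, hb]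

/-- The differential shifts degrees by one, hence the sign. This is what cancels the mixed terms in
`Model.extH_extD`. -/
theorem d_invol (a : A.carrier) : A.d (A.invol a) = -A.invol (A.d a) := by
  induction a using hom_induction with
  | zero => simp
  | hom i a ha =>
    rw [invol_of_mem (A.d_mem ha), invol_of_mem ha, Int.negOnePow_succ, Units.smul_def,
      _root_.map_zsmul, Units.smul_def]
    simp
  | add a b ha hb => simp only [_root_.map_add, ha, hb, neg_add]

theorem Hom.map_invol {B : CDGRing.{u}} (f : Hom A B) (a : A.carrier) :
    f (A.invol a) = B.invol (f a) := by
  induction a using hom_induction with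
  | zero => simp only [_root_.map_zero, Hom.map_zero]
  | hom i a ha =>
    rw [invol_of_mem ha, invol_of_mem (f.map_mem_gr ha), Units.smul_def, Hom.map_zsmul,
      Units.smul_def]
  | add a b ha hb => simp only [_root_.map_add, Hom.map_add, ha, hb]

/-- Writing the sign as the ring endomorphism `invol` frees the Leibniz rule from homogeneity
hypotheses. -/
theorem leibniz' (a b : A.carrier) : A.d (a * b) = A.d a * b + A.invol a * A.d b := by
  induction a using hom_induction with
  | zero => simp
  | hom i a ha =>
    induction b using hom_induction with
    | zero => simp
    | hom j b hb => rw [A.leibniz ha hb, invol_of_mem ha, smul_mul_assoc]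
    | add b c hb hc => simp only [mul_add, _root_.map_add, hb, hc]; abel
  | add a c ha hc => simp only [add_mul, _root_.map_add, ha, hc]; abel

variable (A) in
/-- The `n`-th iterate of the grading involution. -/
noncomputable def involPow (n : ℕ) : A.carrier →+* A.carrier := A.invol ^ n

@[simp] theorem involPow_zero (a : A.carrier) : A.involPow 0 a = a := by
  simp [involPow]

theorem involPow_succ (n : ℕ) (a : A.carrier) :
    A.involPow (n + 1) a = A.involPow n (A.invol a) := by
  simp [involPow, pow_succ]

theorem involPow_add (m n : ℕ) (a : A.carrier) :
    A.involPow (m + n) a = A.involPow m (A.involPow n a) := by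
  simp [involPow, pow_add]

theorem involPow_of_mem (n : ℕ) {i : ℤ} {a : A.carrier} (h : a ∈ A.gr i) :
    A.involPow n a = (n * i).negOnePow • a := by
  induction n generalizing a with
  | zero => simp
  | succ n ih =>
    rw [involPow_succ, ih (invol_mem h), invol_of_mem h, smul_smul, ← Int.negOnePow_add]
    push_cast
    ring_nf

/-- Only the parity of the degree of `w` matters, so it may be replaced by any `n` of the same
parity, in practice the index of a basis element. -/
theorem mul_eq_involPow_mul {i : ℤ} {n : ℕ} (hn : (i.negOnePow) = (n : ℤ).negOnePow)
    {w : A.carrier} (hw : w ∈ A.gr i) (a : A.carrier) : w * a = A.involPow n a * w := by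
  induction a using hom_induction with
  | zero => simp
  | hom j a ha =>
    rw [A.graded_comm ha hw, involPow_of_mem n ha, smul_mul_assoc, mul_comm j i,
      Int.negOnePow_def, Int.negOnePow_def, zpow_mul, zpow_mul, ← Int.negOnePow_def,
      ← Int.negOnePow_def, hn]
  | add a b ha hb => simp only [mul_add, _root_.map_add, add_mul, ha, hb]

end CDGRing

namespace CDGRing

variable {A : CDGRing.{u}}

theorem involPow_congr {m n : ℕ} (h : (m : ℤ).negOnePow = (n : ℤ).negOnePow) (a : A.carrier) :
    A.involPow m a = A.involPow n a := by
  induction a using hom_induction with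
  | zero => simp
  | hom j a ha =>
    rw [involPow_of_mem m ha, involPow_of_mem n ha, Int.negOnePow_def, Int.negOnePow_def, zpow_mul,
      zpow_mul, ← Int.negOnePow_def, ← Int.negOnePow_def, h]
  | add a b ha hb => simp only [_root_.map_add, ha, hb]

theorem involPow_mem (n : ℕ) {i : ℤ} {a : A.carrier} (h : a ∈ A.gr i) :
    A.involPow n a ∈ A.gr i := by
  rw [involPow_of_mem n h, Units.smul_def]
  exact zsmul_mem h _

theorem d_involPow (n : ℕ) (a : A.carrier) :
    A.d (A.involPow n a) = (n : ℤ).negOnePow • A.involPow n (A.d a) := by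
  induction n generalizing a with
  | zero => simp
  | succ n ih =>
    rw [involPow_succ, ih, d_invol, involPow_succ, Nat.cast_succ, Int.negOnePow_succ]
    simp

theorem invol_involPow (n : ℕ) (a : A.carrier) :
    A.invol (A.involPow n a) = A.involPow (n + 1) a := by
  rw [add_comm, involPow_add]
  rfl

theorem Hom.map_involPow {B : CDGRing.{u}} (f : Hom A B) (n : ℕ) (a : A.carrier) :
    f (A.involPow n a) = B.involPow n (f a) := by
  induction n generalizing a with
  | zero => simp only [involPow_zero]
  | succ n ih => rw [involPow_succ, involPow_succ, ih, Hom.map_invol]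

/-! ### Models: contractible CDG rings given by structure constants -/

/-- A CDG ring with a contraction to `ℤ`, given by structure constants with respect to a basis
`(e n)` of homogeneous elements: `e m * e n = c m n • e (m + n)`, `d (e n) = k n • e (τ n)`,
and the contracting homotopy maps `e n` to `l n • e (ρ n)`. -/
structure Model where
  /-- The degrees of the basis elements. -/
  deg : ℕ → ℤ
  /-- The structure constants of the multiplication. -/
  c : ℕ → ℕ → ℤ
  /-- The coefficients of the differential. -/
  k : ℕ → ℤ
  /-- The indices of the differential. -/
  τ : ℕ → ℕ
  /-- The coefficients of the homotopy. -/
  l : ℕ → ℤ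
  /-- The indices of the homotopy. -/
  ρ : ℕ → ℕ
  deg_zero : deg 0 = 0
  deg_nonpos : ∀ n, deg n ≤ 0
  deg_parity : ∀ n, (deg n).negOnePow = (n : ℤ).negOnePow
  c_zero_left : ∀ n, c 0 n = 1
  c_zero_right : ∀ n, c n 0 = 1
  c_assoc : ∀ m n p, c m n * c (m + n) p = c n p * c m (n + p)
  c_comm : ∀ m n, c m n = c n m
  c_odd : ∀ m n, Odd m → Odd n → c m n = 0
  deg_add : ∀ m n, c m n ≠ 0 → deg (m + n) = deg m + deg n
  deg_τ : ∀ n, k n ≠ 0 → deg (τ n) = deg n + 1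
  τ_ne_zero : ∀ n, k n ≠ 0 → τ n ≠ 0
  k_mul_k : ∀ n, k n * k (τ n) = 0
  -- An identity of formal combinations rather than of coefficients: the three indices need not
  -- agree when some of the coefficients vanish.
  leibniz : ∀ m n, (Finsupp.single (τ (m + n)) (c m n * k (m + n)) : ℕ →₀ ℤ) =
    Finsupp.single (τ m + n) (k m * c (τ m) n) +
      Finsupp.single (m + τ n) (((m : ℤ).negOnePow : ℤ) * (k n * c m (τ n)))
  deg_ρ : ∀ n, l n ≠ 0 → deg (ρ n) = deg n - 1
  contraction : ∀ n, (Finsupp.single (τ (ρ n)) (l n * k (ρ n)) : ℕ →₀ ℤ) +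
    Finsupp.single (ρ (τ n)) (k n * l (τ n)) = if n = 0 then 0 else Finsupp.single n 1

namespace Model

variable (K : Model)

/-- Adding up the coefficients in the Leibniz rule for `e 0 * e 0` gives `k 0 = 2 * k 0`. -/
theorem k_zero : K.k 0 = 0 := by
  have h := congrArg (fun f => f.sum fun _ z => z) (K.leibniz 0 0)
  simp only [Finsupp.sum_single_index, c_zero_left, c_zero_right, add_zero,
    zero_add, one_mul, mul_one, Nat.cast_zero, Int.negOnePow_zero, Units.val_one] at h
  rw [Finsupp.sum_add_index' (fun _ => rfl) (fun _ _ _ => rfl)] at h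
  simp only [Finsupp.sum_single_index] at h
  omega

/-- A homomorphism from a model to a CDG ring, given by the images of the basis elements. -/
structure Family (R : CDGRing.{u}) where
  /-- The images of the basis elements. -/
  w : ℕ → R.carrier
  mem : ∀ n, w n ∈ R.gr (K.deg n)
  one : w 0 = 1
  mul : ∀ m n, w m * w n = K.c m n • w (m + n)
  d_w : ∀ n, R.d (w n) = K.k n • w (K.τ n)

variable {K}

/-- The image of a family under a homomorphism. -/
def Family.map {R S : CDGRing.{u}} (F : K.Family R) (f : Hom R S) : K.Family S where
  w n := f (F.w n)
  mem n := f.map_mem_gr (F.mem n)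
  one := by rw [F.one, Hom.map_one]
  mul m n := by rw [← Hom.map_mul, F.mul, Hom.map_zsmul]
  d_w n := by rw [← f.map_d, F.d_w, Hom.map_zsmul]

variable (K) in
/-- The augmentation of a model. -/
def augmentation (R : CDGRing.{u}) : K.Family R where
  w n := if n = 0 then 1 else 0
  mem n := by
    split_ifs with h
    · rw [h, K.deg_zero]
      exact one_mem_gr
    · exact zero_mem _
  one := if_pos rfl
  mul m n := by
    rcases eq_or_ne m 0 with rfl | hm
    · simp [K.c_zero_left]
    · simp [hm]
  d_w n := by
    rcases eq_or_ne n 0 with rfl | hn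
    · simp [d_one, K.k_zero]
    · rcases eq_or_ne (K.k n) 0 with h | h
      · simp [hn, h]
      · simp [hn, K.τ_ne_zero n h]

/-! ### The extension `R ⊗ K` and its contraction onto `R` -/

variable (K) (R : CDGRing.{u})

/-- The coefficients of the extension of `R` by `K`. -/
@[nolint unusedArguments]
def Coeff (_ : Model) (R : CDGRing.{u}) (_ : ℕ) : Type u := R.carrier

instance (n : ℕ) : AddCommGroup (Coeff K R n) := inferInstanceAs (AddCommGroup R.carrier)

theorem mk_coeff_eq {m n : ℕ} (h : m = n) {x y : R.carrier} (hxy : x = y) :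
    (⟨m, x⟩ : GradedMonoid (Coeff K R)) = ⟨n, y⟩ := by
  subst h hxy
  rfl

/-- The multiplication of coefficients in degrees `m` and `n`. -/
noncomputable def coeffMul (m n : ℕ) (a b : R.carrier) : R.carrier :=
  K.c m n • (a * R.involPow m b)

variable {K R}

theorem coeffMul_zero (m n : ℕ) (a : R.carrier) : coeffMul K R m n a 0 = 0 := by simp [coeffMul]

theorem zero_coeffMul (m n : ℕ) (a : R.carrier) : coeffMul K R m n 0 a = 0 := by simp [coeffMul]

theorem coeffMul_add (m n : ℕ) (a b c : R.carrier) :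
    coeffMul K R m n a (b + c) = coeffMul K R m n a b + coeffMul K R m n a c := by
  simp only [coeffMul, map_add, mul_add, smul_add]

theorem add_coeffMul (m n : ℕ) (a b c : R.carrier) :
    coeffMul K R m n (a + b) c = coeffMul K R m n a c + coeffMul K R m n b c := by
  simp only [coeffMul, add_mul, smul_add]

theorem one_coeffMul (n : ℕ) (a : R.carrier) : coeffMul K R 0 n 1 a = a := by
  simp [coeffMul, K.c_zero_left]

theorem coeffMul_one (n : ℕ) (a : R.carrier) : coeffMul K R n 0 a 1 = a := by
  simp [coeffMul, K.c_zero_right]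

theorem coeffMul_assoc (m n p : ℕ) (a b c : R.carrier) :
    coeffMul K R (m + n) p (coeffMul K R m n a b) c =
      coeffMul K R m (n + p) a (coeffMul K R n p b c) := by
  simp only [coeffMul, map_zsmul, map_mul, ← involPow_add, smul_mul_assoc, mul_smul_comm,
    smul_smul, mul_assoc]
  rw [mul_comm (K.c (m + n) p), K.c_assoc, mul_comm (K.c n p)]

variable (K R)

instance : GradedMonoid.GOne (Coeff K R) := ⟨(1 : R.carrier)⟩

noncomputable instance : GradedMonoid.GMul (Coeff K R) := ⟨fun {m n} a b => coeffMul K R m n a b⟩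

noncomputable instance : DirectSum.GRing (Coeff K R) where
  mul_zero := coeffMul_zero _ _
  zero_mul := zero_coeffMul _ _
  mul_add := coeffMul_add _ _
  add_mul := add_coeffMul _ _
  one_mul := fun ⟨n, a⟩ => mk_coeff_eq K R (zero_add n) (one_coeffMul n a)
  mul_one := fun ⟨n, a⟩ => mk_coeff_eq K R (add_zero n) (coeffMul_one n a)
  mul_assoc := fun ⟨m, a⟩ ⟨n, b⟩ ⟨p, c⟩ =>
    mk_coeff_eq K R (add_assoc m n p) (coeffMul_assoc m n p a b c)
  natCast n := (n : R.carrier)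
  natCast_zero := Nat.cast_zero (R := R.carrier)
  natCast_succ n := Nat.cast_succ (R := R.carrier) n
  intCast n := (n : R.carrier)
  intCast_ofNat n := Int.cast_natCast (R := R.carrier) n
  intCast_negSucc_ofNat n := Int.cast_negSucc (R := R.carrier) n

/-- The ring underlying the extension of `R` by `K`. -/
abbrev Ext : Type u := DirectSum ℕ (Coeff K R)

/-- The elements `r * e n`. -/
def mono (n : ℕ) : R.carrier →+ Ext K R := DirectSum.of (Coeff K R) n

variable {K R}

theorem mono_mul (m n : ℕ) (r s : R.carrier) :
    mono K R m r * mono K R n s = K.c m n • mono K R (m + n) (r * R.involPow m s) := by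
  rw [← map_zsmul]
  exact DirectSum.of_mul_of (A := Coeff K R) (i := m) (j := n) r s

@[elab_as_elim]
theorem ext_induction {p : Ext K R → Prop} (mono : ∀ n r, p (mono K R n r))
    (add : ∀ x y, p x → p y → p (x + y)) (x : Ext K R) : p x := by
  induction x using DirectSum.induction_on with
  | zero => simpa using mono 0 0
  | of n r => exact mono n r
  | add x y hx hy => exact add x y hx hy

/-- Additive maps out of `Ext K R`. -/
def extLift {G : Type*} [AddCommGroup G] (φ : ℕ → R.carrier →+ G) : Ext K R →+ G :=
  DirectSum.toAddMonoid (β := Coeff K R) φ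

@[simp]
theorem extLift_mono {G : Type*} [AddCommGroup G] (φ : ℕ → R.carrier →+ G) (n : ℕ) (r : R.carrier) :
    extLift (K := K) φ (mono K R n r) = φ n r :=
  DirectSum.toAddMonoid_of (β := Coeff K R) φ n r

variable (K R)

/-- The differential of the extension. -/
noncomputable def extD : Ext K R →+ Ext K R :=
  extLift fun n => (mono K R n).comp R.d +
    K.k n • (mono K R (K.τ n)).comp R.invol.toAddMonoidHom

/-- The homotopy of the extension. -/
noncomputable def extH : Ext K R →+ Ext K R :=
  extLift fun n => K.l n • (mono K R (K.ρ n)).comp R.invol.toAddMonoidHom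

variable {K R}

theorem extD_mono (n : ℕ) (r : R.carrier) : extD K R (mono K R n r) =
    mono K R n (R.d r) + K.k n • mono K R (K.τ n) (R.invol r) := by
  rw [extD, extLift_mono]
  rfl

theorem extH_mono (n : ℕ) (r : R.carrier) : extH K R (mono K R n r) =
    K.l n • mono K R (K.ρ n) (R.invol r) := by
  rw [extH, extLift_mono]
  rfl

/-- Integral combinations of the basis elements, times an element of `R`. -/
noncomputable def comb (r : R.carrier) : (ℕ →₀ ℤ) →+ Ext K R :=
  Finsupp.liftAddHom fun n => (zmultiplesHom (Ext K R) (mono K R n r))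

@[simp]
theorem comb_single (r : R.carrier) (n : ℕ) (z : ℤ) :
    comb (K := K) r (Finsupp.single n z) = z • mono K R n r := by
  simp [comb]

theorem extD_extD (x : Ext K R) : extD K R (extD K R x) = 0 := by
  induction x using ext_induction with
  | mono n r =>
    rw [extD_mono, map_add, map_zsmul, extD_mono, extD_mono, R.d_d, d_invol, smul_add, smul_smul,
      K.k_mul_k]
    simp
  | add x y hx hy => rw [map_add, map_add, hx, hy, add_zero]

/-- On `r * e n`, the terms containing `d r` cancel because `d` and the involution anticommute. What
is left is `r` times the contraction identity of the model. -/
theorem extH_extD (x : Ext K R) : extD K R (extH K R x) + extH K R (extD K R x) =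
    x - mono K R 0 (extLift (fun n => if n = 0 then AddMonoidHom.id _ else 0) x) := by
  induction x using ext_induction with
  | mono n r =>
    rw [extD_mono, map_add, extH_mono, map_zsmul, map_zsmul, extD_mono, extH_mono, extH_mono,
      d_invol, invol_invol, map_neg, smul_add, smul_neg, smul_smul, smul_smul, extLift_mono]
    have h := congrArg (comb (K := K) r) (K.contraction n)
    rw [map_add, comb_single, comb_single] at h
    rw [neg_add_eq_sub]
    have e : ∀ a b c : Ext K R, a - b + (b + c) = a + c := fun a b c => by abel
    rw [e, h]
    split_ifs with h0
    · simp [h0]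
    · simp
  | add x y hx hy =>
    simp only [map_add]
    rw [add_add_add_comm, hx, hy]
    abel

/-- Indices have the parity of degrees and `d` has degree 1, so `τ n` has the parity of `n + 1` even
when it is not `n + 1`. -/
theorem negOnePow_τ {n : ℕ} (h : K.k n ≠ 0) :
    ((K.τ n : ℕ) : ℤ).negOnePow = ((n + 1 : ℕ) : ℤ).negOnePow := by
  rw [← K.deg_parity, K.deg_τ n h, Nat.cast_succ, Int.negOnePow_succ, Int.negOnePow_succ,
    K.deg_parity]

/-- The sign of the first factor splits into the part of `r`, carried by `invol`, and the part of `e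
m`, which is that of `m`. The terms that differentiate basis elements match by the Leibniz rule of
the model. -/
theorem extD_mono_mul (m n : ℕ) (r s : R.carrier) :
    extD K R (mono K R m r * mono K R n s) = extD K R (mono K R m r) * mono K R n s +
      ((m : ℤ).negOnePow : ℤ) • (mono K R m (R.invol r) * extD K R (mono K R n s)) := by
  have h := congrArg (comb (K := K) (R.invol r * R.involPow (m + 1) s)) (K.leibniz m n)
  rw [map_add, comb_single, comb_single, comb_single] at h
  have h1 : (K.k m * K.c (K.τ m) n) • mono K R (K.τ m + n) (R.invol r * R.involPow (K.τ m) s) =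
      (K.k m * K.c (K.τ m) n) • mono K R (K.τ m + n) (R.invol r * R.involPow (m + 1) s) := by
    by_cases hk : K.k m = 0
    · simp [hk]
    · rw [involPow_congr (negOnePow_τ hk)]
  simp only [mono_mul, map_zsmul, extD_mono, add_mul, mul_add, leibniz', d_involPow, map_mul,
    invol_involPow, smul_add, smul_mul_assoc, mul_smul_comm, map_add, Units.smul_def]
  simp only [smul_smul]
  rw [h, h1, ← involPow_succ]
  rw [mul_comm (K.c m n) ((m : ℤ).negOnePow : ℤ)]
  abel

/-- The homogeneous components of the extension. -/
noncomputable def extGr (K : Model) (R : CDGRing.{u}) (j : ℤ) : AddSubgroup (Ext K R) :=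
  AddSubgroup.closure {x | ∃ n i r, r ∈ R.gr i ∧ i + K.deg n = j ∧ mono K R n r = x}

theorem mono_mem {n : ℕ} {i j : ℤ} {r : R.carrier} (hr : r ∈ R.gr i) (h : i + K.deg n = j) :
    mono K R n r ∈ extGr K R j :=
  AddSubgroup.subset_closure ⟨n, i, r, hr, h, rfl⟩

theorem zsmul_mono_mem {n : ℕ} {z i j : ℤ} {r : R.carrier} (hr : r ∈ R.gr i)
    (h : z ≠ 0 → i + K.deg n = j) : z • mono K R n r ∈ extGr K R j := by
  by_cases hz : z = 0
  · rw [hz, zero_smul]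
    exact zero_mem _
  · exact zsmul_mem (mono_mem hr (h hz)) z

@[elab_as_elim]
theorem extGr_induction {j : ℤ} {p : (x : Ext K R) → x ∈ extGr K R j → Prop}
    (mono : ∀ n i r (hr : r ∈ R.gr i) (h : i + K.deg n = j), p (mono K R n r) (mono_mem hr h))
    (add : ∀ x y hx hy, p x hx → p y hy → p (x + y) (add_mem hx hy)) {x : Ext K R}
    (hx : x ∈ extGr K R j) : p x hx := by
  refine AddSubgroup.closure_induction_left (p := p) ?_ ?_ ?_ hx
  · have := mono 0 j 0 (zero_mem _) (by rw [K.deg_zero, add_zero])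
    simpa only [map_zero] using this
  · rintro x ⟨n, i, r, hr, h, rfl⟩ y hy' hy
    exact add _ _ (mono_mem hr h) hy' (mono n i r hr h) hy
  · rintro x ⟨n, i, r, hr, h, rfl⟩ y hy' hy
    have := mono n i _ (neg_mem hr) h
    simp only [map_neg] at this
    exact add _ _ _ hy' this hy

theorem ext_mul_mem {i j : ℤ} {x y : Ext K R} (hx : x ∈ extGr K R i) (hy : y ∈ extGr K R j) :
    x * y ∈ extGr K R (i + j) := by
  induction hx using extGr_induction with
  | mono m i' r hr hi =>
    induction hy using extGr_induction with
    | mono n j' s hs hj =>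
      rw [mono_mul]
      refine zsmul_mono_mem (mul_mem_gr hr (involPow_mem m hs)) fun h => ?_
      rw [K.deg_add m n h]
      omega
    | add y z _ _ hy hz => rw [mul_add]; exact add_mem hy hz
  | add x z _ _ hx hz => rw [add_mul]; exact add_mem hx hz

theorem extD_mem {i : ℤ} {x : Ext K R} (hx : x ∈ extGr K R i) : extD K R x ∈ extGr K R (i + 1) := by
  induction hx using extGr_induction with
  | mono m i' r hr hi =>
    rw [extD_mono]
    refine add_mem (mono_mem (R.d_mem hr) (by omega))
      (zsmul_mono_mem (invol_mem hr) fun h => ?_)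
    rw [K.deg_τ m h]
    omega
  | add x z _ _ hx hz => rw [map_add]; exact add_mem hx hz

theorem extH_mem {i : ℤ} {x : Ext K R} (hx : x ∈ extGr K R i) :
    extH K R x ∈ extGr K R (i - 1) := by
  induction hx using extGr_induction with
  | mono m i' r hr hi =>
    rw [extH_mono]
    refine zsmul_mono_mem (invol_mem hr) fun h => ?_
    rw [K.deg_ρ m h]
    omega
  | add x z _ _ hx hz => rw [map_add]; exact add_mem hx hz

theorem ext_graded_comm {i j : ℤ} {x y : Ext K R} (hx : x ∈ extGr K R i) (hy : y ∈ extGr K R j) :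
    y * x = (i * j).negOnePow • (x * y) := by
  induction hx using extGr_induction with
  | mono m i' r hr hi =>
    induction hy using extGr_induction with
    | mono n j' s hs hj =>
      rw [mono_mul, mono_mul, add_comm n m, K.c_comm n m]
      -- If both indices are odd, both products vanish. Otherwise `m * n` is even, so the symmetry
      -- of `c` carries the right sign.
      by_cases hodd : Odd m ∧ Odd n
      · simp [K.c_odd m n hodd.1 hodd.2]
      · rw [smul_comm]
        congr 1
        rw [Units.smul_def, ← map_zsmul]
        congr 1
        rw [involPow_of_mem n hr, involPow_of_mem m hs, mul_smul_comm, R.graded_comm hr hs,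
          mul_smul_comm, ← Units.smul_def, smul_smul, smul_smul, ← Int.negOnePow_add,
          ← Int.negOnePow_add]
        congr 1
        rw [Int.negOnePow_eq_iff]
        obtain ⟨p, hp⟩ := (Int.negOnePow_eq_iff _ _).1 (K.deg_parity m)
        obtain ⟨q, hq⟩ := (Int.negOnePow_eq_iff _ _).1 (K.deg_parity n)
        have hmn : Even ((m : ℤ) * n) := by
          rw [not_and_or, Nat.not_odd_iff_even, Nat.not_odd_iff_even] at hodd
          rw [Int.even_mul, Int.even_coe_nat, Int.even_coe_nat]
          exact hodd
        obtain ⟨t, ht⟩ := hmn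
        have e1 : K.deg m = m + 2 * p := by omega
        have e2 : K.deg n = n + 2 * q := by omega
        subst hi hj
        -- Half of the difference `(n * i' + i' * j') - (i * j + m * j')` of the two sign exponents,
        -- after expanding `i * j` with `deg m = m + 2p`, `deg n = n + 2q` and `m * n = 2t`.
        refine ⟨-(i' * q) - p * j' - m * j' - t - m * q - n * p - 2 * p * q, ?_⟩
        rw [e1, e2]
        linear_combination (-1 : ℤ) * ht
    | add y z _ _ hy hz => rw [mul_add, add_mul, hy, hz, smul_add]
  | add x z _ _ hx hz => rw [mul_add, add_mul, hx, hz, smul_add]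

/-- For `r * e m`, either `m` is even and `r` is odd with square zero, or `m` is odd and `c m m =
0`. In a sum the cross terms cancel by graded commutativity. -/
theorem ext_odd_sq {i : ℤ} {x : Ext K R} (hi : Odd i) (hx : x ∈ extGr K R i) : x * x = 0 := by
  induction hx using extGr_induction with
  | mono m i' r hr h =>
    rw [mono_mul]
    rcases Nat.even_or_odd m with hm | hm
    · have : Odd i' := by
        have h2 : Even (K.deg m) := by
          rw [← Int.negOnePow_eq_one_iff, K.deg_parity, Int.negOnePow_eq_one_iff]
          exact_mod_cast hm
        rw [← h] at hi
        by_contra h3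
        rw [Int.not_odd_iff_even] at h3
        exact (Int.not_odd_iff_even.2 (h3.add h2)) hi
      rw [involPow_of_mem m hr, mul_smul_comm, R.odd_sq this hr]
      simp
    · rw [K.c_odd m m hm hm, zero_smul]
  | add x y hx' hy' hx hy =>
    have := ext_graded_comm hx' hy'
    rw [Int.negOnePow_odd _ (hi.mul hi)] at this
    simp [mul_add, add_mul, hx, hy, this]

/-- The projections to the homogeneous components of the extension. -/
noncomputable def extProj (K : Model) (R : CDGRing.{u}) (j : ℤ) : Ext K R →+ Ext K R :=
  extLift fun n => (mono K R n).comp (R.proj (j - K.deg n))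

theorem extProj_mono (j : ℤ) (n : ℕ) (r : R.carrier) : extProj K R j (mono K R n r) =
    mono K R n (R.proj (j - K.deg n) r) := by
  rw [extProj, extLift_mono]
  rfl

noncomputable instance : DirectSum.Decomposition (extGr K R) := by
  refine decompositionOfProj _ (extProj K R) (fun i x hx => ?_) (fun i j hij x hx => ?_)
    (fun x => ?_)
  · induction hx using extGr_induction with
    | mono n i' r hr h => rw [extProj_mono, proj_same (by rwa [← h, add_sub_cancel_right])]
    | add x y _ _ hx hy => rw [map_add, hx, hy]
  · induction hx using extGr_induction with
    | mono n i' r hr h => rw [extProj_mono, proj_ne hr (by omega), map_zero]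
    | add x y _ _ hx hy => rw [map_add, hx, hy, add_zero]
  · induction x using ext_induction with
    | mono n r =>
      induction r using hom_induction with
      | zero => rw [map_zero]; exact zero_mem _
      | hom i r hr =>
        exact AddSubgroup.subset_closure (Set.mem_iUnion.2 ⟨_, mono_mem hr rfl⟩)
      | add r s hr hs => rw [map_add]; exact add_mem hr hs
    | add x y hx hy => exact add_mem hx hy

noncomputable instance : GradedRing (extGr K R) where
  one_mem := mono_mem one_mem_gr (by rw [K.deg_zero, add_zero])
  mul_mem _ _ _ _ := ext_mul_mem

variable (K R)

/-- The extension of `R` by the model `K`, that is `R ⊗ K`. -/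
noncomputable def extend : CDGRing.{u} where
  carrier := Ext K R
  gr := extGr K R
  gr_eq_bot j hj := by
    rw [eq_bot_iff]
    intro x hx
    rw [AddSubgroup.mem_bot]
    induction hx using extGr_induction with
    | mono n i r hr h =>
      have := K.deg_nonpos n
      rw [R.gr_eq_bot i (by omega), AddSubgroup.mem_bot] at hr
      rw [hr, map_zero]
    | add x y _ _ hx hy => rw [hx, hy, add_zero]
  graded_comm := ext_graded_comm
  odd_sq := ext_odd_sq
  d := extD K R
  d_mem := extD_mem
  d_d := extD_extD
  leibniz {i j x y} hx hy := by
    induction hx using extGr_induction with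
    | mono m i' r hr hi =>
      induction hy using extGr_induction with
      | mono n j' s hs hj =>
        rw [extD_mono_mul, invol_of_mem hr]
        congr 1
        rw [Units.smul_def, map_zsmul, smul_mul_assoc, smul_smul, ← hi, Int.negOnePow_add,
          K.deg_parity, Units.smul_def, Units.val_mul, mul_comm]
      | add y z _ _ hy hz => rw [mul_add, map_add, hy, hz, map_add, mul_add, mul_add, smul_add]; abel
    | add x z _ _ hx hz => rw [add_mul, map_add, hx, hz, map_add, add_mul, add_mul, smul_add]; abel

/-- The inclusion of the coefficients. -/
noncomputable def incl : Hom R (extend K R) where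
  toFun := mono K R 0
  map_zero' := map_zero _
  map_add' := map_add _
  map_one' := rfl
  map_mul' r s := by
    change _ = mono K R 0 r * mono K R 0 s
    rw [mono_mul, K.c_zero_left, one_smul, involPow_zero]
  map_mem hr := mono_mem hr (by rw [K.deg_zero, add_zero])
  map_d r := by
    change _ = extD K R (mono K R 0 r)
    rw [extD_mono, K.k_zero, zero_smul, add_zero]

/-- The tautological family in the extension. -/
noncomputable def tautFamily : K.Family (extend K R) where
  w n := mono K R n 1
  mem n := mono_mem one_mem_gr (zero_add _)
  one := rfl
  mul m n := by
    refine (mono_mul m n 1 1).trans ?_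
    rw [map_one, one_mul]
    rfl
  d_w n := by
    refine (extD_mono n 1).trans ?_
    rw [d_one, map_zero, map_one, zero_add]
    rfl

variable {K R}

/-- The additive map underlying `lift`. -/
def liftAdd {S : CDGRing.{u}} (g : Hom R S) (F : K.Family S) : Ext K R →+ S.carrier :=
  extLift fun n => (AddMonoidHom.mulRight (F.w n)).comp g.toRingHom.toAddMonoidHom

theorem liftAdd_mono {S : CDGRing.{u}} (g : Hom R S) (F : K.Family S) (n : ℕ) (r : R.carrier) :
    liftAdd g F (mono K R n r) = g r * F.w n :=
  extLift_mono (K := K) _ n r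

/-- The universal property of the extension. -/
noncomputable def lift {S : CDGRing.{u}} (g : Hom R S) (F : K.Family S) : Hom (extend K R) S where
  toRingHom := DirectSum.toSemiring (A := Coeff K R)
    (fun n => (AddMonoidHom.mulRight (F.w n)).comp g.toRingHom.toAddMonoidHom)
    (by
      change g 1 * F.w 0 = 1
      rw [F.one, Hom.map_one, one_mul])
    (by
      intro m n (r : R.carrier) (s : R.carrier)
      change g (coeffMul K R m n r s) * F.w (m + n) = (g r * F.w m) * (g s * F.w n)
      -- Moving `F.w m` past `g s` produces exactly the twist `involPow m` built into the product of
      -- the extension.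
      rw [coeffMul, Hom.map_zsmul, Hom.map_mul, Hom.map_involPow, smul_mul_assoc, mul_assoc, mul_assoc, ← mul_smul_comm,
        ← mul_smul_comm, ← F.mul, ← mul_assoc (S.involPow m (g s)),
        ← mul_eq_involPow_mul (K.deg_parity m) (F.mem m) (g s)]
      simp only [mul_assoc])
  map_mem {i x} hx := by
    induction hx using extGr_induction with
    | mono n i' r hr h =>
      have : g r * F.w n ∈ S.gr i := h ▸ mul_mem_gr (g.map_mem_gr hr) (F.mem n)
      refine Set.mem_of_eq_of_mem ?_ this
      exact liftAdd_mono g F n r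
    | add x y _ _ hx hy =>
      refine Set.mem_of_eq_of_mem ?_ (add_mem hx hy)
      exact _root_.map_add _ x y
  map_d x := by
    refine DFunLike.congr_fun (f := (liftAdd g F).comp (extD K R)) (g := S.d.comp (liftAdd g F))
      ?_ x
    refine AddMonoidHom.ext fun y => ?_
    induction y using ext_induction with
    | mono n r =>
      rw [AddMonoidHom.comp_apply, AddMonoidHom.comp_apply, extD_mono, map_add, map_zsmul,
        liftAdd_mono, liftAdd_mono, liftAdd_mono, leibniz', F.d_w, mul_smul_comm, Hom.map_invol,
        g.map_d]
    | add y z hy hz => rw [map_add, map_add, hy, hz]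

theorem lift_mono {S : CDGRing.{u}} (g : Hom R S) (F : K.Family S) (n : ℕ) (r : R.carrier) :
    lift g F (mono K R n r) = g r * F.w n :=
  liftAdd_mono g F n r

theorem lift_incl {S : CDGRing.{u}} (g : Hom R S) (F : K.Family S) (r : R.carrier) :
    lift g F (incl K R r) = g r := by
  refine (lift_mono g F 0 r).trans ?_
  rw [F.one, mul_one]

theorem lift_taut {S : CDGRing.{u}} (g : Hom R S) (F : K.Family S) (n : ℕ) :
    lift g F ((tautFamily K R).w n) = F.w n := by
  refine (lift_mono g F n 1).trans ?_
  rw [Hom.map_one, one_mul]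

variable (K R) in
/-- The homotopy on the extension. -/
noncomputable def extendH : (extend K R).carrier →+ (extend K R).carrier := extH K R

/-- The extension is homotopy equivalent to `R`. -/
theorem extH_homotopy (x : (extend K R).carrier) :
    (extend K R).d (extendH K R x) + extendH K R ((extend K R).d x) =
      x - incl K R (lift (Hom.id R) (K.augmentation R) x) := by
  refine (extH_extD x).trans ?_
  congr 3
  change _ = liftAdd (Hom.id R) (K.augmentation R)
  refine AddMonoidHom.ext fun y => ?_
  induction y using ext_induction with
  | mono n r =>
    rw [extLift_mono, liftAdd_mono]
    by_cases h : n = 0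
    · simp only [h, if_true, augmentation, mul_one]
      rfl
    · simp [augmentation, h]
  | add y z hy hz => rw [map_add, map_add, hy, hz]

end Model
end CDGRing

/-! ### The coproduct of `A` and a family of models -/

namespace CDGRing

open Model

variable (A : CDGRing.{u}) {I : Type u} (K : I → Model)

/-- A CDG ring under `A` and under all the models `K b`. -/
structure Cocone where
  /-- The CDG ring. -/
  R : CDGRing.{u}
  /-- The homomorphism from `A`. -/
  g : Hom A R
  /-- The families, i.e. the homomorphisms from the models. -/
  F : ∀ b, (K b).Family R

/-- Expressions for elements of a CDG ring under `A` and under models indexed by `I`. -/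
inductive Expr (A : CDGRing.{u}) (I : Type u) : Type u
  | of (a : A.carrier)
  | gen (b : I) (n : ℕ)
  | add (s t : Expr A I)
  | neg (s : Expr A I)
  | mul (s t : Expr A I)
  | d (s : Expr A I)
  | proj (i : ℤ) (s : Expr A I)

variable {A K}

/-- The value of an expression. -/
noncomputable def Cocone.eval (D : Cocone A K) : Expr A I → D.R.carrier
  | .of a => D.g a
  | .gen b n => (D.F b).w n
  | .add s t => D.eval s + D.eval t
  | .neg s => -D.eval s
  | .mul s t => D.eval s * D.eval t
  | .d s => D.R.d (D.eval s)
  | .proj i s => D.R.proj i (D.eval s)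

/-- The finite set of degrees must not depend on the cocone: an element of the infinite product is a
finite sum of homogeneous ones only if the supports of its components are uniformly bounded. -/
theorem Cocone.exists_support_eval (K : I → Model) (t : Expr A I) :
    ∃ s : Finset ℤ, ∀ (D : Cocone A K), ∀ i ∉ s, D.R.proj i (D.eval t) = 0 := by
  classical
  induction t with
  | of a =>
    obtain ⟨s, hs⟩ := exists_support a
    refine ⟨s, fun D i hi => ?_⟩
    rw [eval, ← Hom.map_proj, hs i hi, Hom.map_zero]
  | gen b n =>
    refine ⟨{(K b).deg n}, fun D i hi => ?_⟩
    exact proj_ne ((D.F b).mem n) (by simpa using hi)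
  | add t t' h h' =>
    obtain ⟨s, hs⟩ := h
    obtain ⟨s', hs'⟩ := h'
    refine ⟨s ∪ s', fun D i hi => ?_⟩
    rw [Finset.mem_union, not_or] at hi
    rw [eval, map_add, hs D i hi.1, hs' D i hi.2, add_zero]
  | neg t h =>
    obtain ⟨s, hs⟩ := h
    refine ⟨s, fun D i hi => ?_⟩
    rw [eval, map_neg, hs D i hi, neg_zero]
  | mul t t' h h' =>
    obtain ⟨s, hs⟩ := h
    obtain ⟨s', hs'⟩ := h'
    exact ⟨_, fun D i hi => proj_mul_eq_zero (hs D) (hs' D) hi⟩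
  | d t h =>
    obtain ⟨s, hs⟩ := h
    refine ⟨s.image (· + 1), fun D i hi => ?_⟩
    rw [eval, proj_d, hs D (i - 1), map_zero]
    intro hi'
    exact hi (Finset.mem_image.2 ⟨i - 1, hi', sub_add_cancel i 1⟩)
  | proj j t h =>
    refine ⟨{j}, fun D i hi => ?_⟩
    exact proj_ne (proj_mem j _) (by simpa using hi)

variable (A K)

/-- The values of expressions, as elements of the product over all cocones. -/
noncomputable def valueRing : Subring (∀ D : Cocone A K, D.R.carrier) where
  carrier := Set.range fun (t : Expr A I) (D : Cocone A K) => D.eval t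
  zero_mem' := ⟨.of 0, funext fun D => D.g.map_zero⟩
  one_mem' := ⟨.of 1, funext fun D => D.g.map_one⟩
  add_mem' := by
    rintro _ _ ⟨s, rfl⟩ ⟨t, rfl⟩
    exact ⟨.add s t, rfl⟩
  neg_mem' := by
    rintro _ ⟨s, rfl⟩
    exact ⟨.neg s, rfl⟩
  mul_mem' := by
    rintro _ _ ⟨s, rfl⟩ ⟨t, rfl⟩
    exact ⟨.mul s t, rfl⟩

/-- Cocones live one universe higher, but expressions form a type in `Type u`, and so does the set
of their values up to equivalence. -/
instance : Small.{u} (valueRing A K) :=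
  small_range fun (t : Expr A I) (D : Cocone A K) => D.eval t

/-- The ring underlying the coproduct of `A` and the models `K b`. -/
def CoprodRing : Type u := Shrink.{u} (valueRing A K)

noncomputable instance : Ring (CoprodRing A K) := inferInstanceAs (Ring (Shrink (valueRing A K)))

namespace CoprodRing

variable {A K}

/-- The component at a cocone. -/
noncomputable def val (D : Cocone A K) : CoprodRing A K →+* D.R.carrier :=
  (Pi.evalRingHom _ D).comp
    ((valueRing A K).subtype.comp (Shrink.ringEquiv (valueRing A K)).toRingHom)

theorem val_injective {x y : CoprodRing A K} (h : ∀ D, val D x = val D y) : x = y :=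
  (Shrink.ringEquiv (valueRing A K)).injective (Subtype.ext (funext h))

/-- The element given by an expression. -/
noncomputable def ofExpr (t : Expr A I) : CoprodRing A K :=
  (Shrink.ringEquiv (valueRing A K)).symm ⟨_, t, rfl⟩

theorem val_ofExpr (D : Cocone A K) (t : Expr A I) : val D (ofExpr t) = D.eval t :=
  congrArg (fun y : valueRing A K => y.1 D) ((Shrink.ringEquiv (valueRing A K)).apply_symm_apply _)

theorem val_of (D : Cocone A K) (a : A.carrier) : val D (ofExpr (.of a)) = D.g a :=
  val_ofExpr D _

theorem exists_ofExpr (x : CoprodRing A K) : ∃ t, ofExpr t = x := by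
  obtain ⟨⟨_, t, rfl⟩, rfl⟩ := (Shrink.ringEquiv (valueRing A K)).symm.surjective x
  exact ⟨t, rfl⟩

/-- The homogeneous components. -/
noncomputable def component (i : ℤ) : AddSubgroup (CoprodRing A K) :=
  ⨅ D : Cocone A K, (D.R.gr i).comap (val D).toAddMonoidHom

theorem mem_component {i : ℤ} {x : CoprodRing A K} : x ∈ component i ↔ ∀ D, val D x ∈ D.R.gr i := by
  simp [component, AddSubgroup.mem_iInf]

/-- An additive operation on `CoprodRing A K` given by an operation on expressions. -/
noncomputable def liftOp (o : Expr A I → Expr A I)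
    (φ : ∀ D : Cocone A K, D.R.carrier →+ D.R.carrier) (h : ∀ D t, D.eval (o t) = φ D (D.eval t)) :
    {ψ : CoprodRing A K →+ CoprodRing A K // ∀ D x, val D (ψ x) = φ D (val D x)} :=
  -- The choice of an expression for `x` is harmless, since `φ D` only sees its value.
  have key : ∀ D x, val D (ofExpr (o (exists_ofExpr (K := K) x).choose)) = φ D (val D x) := fun D x => by
    rw [val_ofExpr, h, ← val_ofExpr, (exists_ofExpr x).choose_spec]
  ⟨{  toFun := fun x => ofExpr (o (exists_ofExpr x).choose)
      map_zero' := val_injective fun D => by rw [key, map_zero, map_zero]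
      map_add' := fun x y => val_injective fun D => by
        rw [map_add, key, key, key, map_add, map_add] }, key⟩

variable (A K) in
/-- The differential. -/
noncomputable def diff : CoprodRing A K →+ CoprodRing A K :=
  (liftOp .d (fun D => D.R.d) fun _ _ => rfl).1

theorem val_d (D : Cocone A K) (x : CoprodRing A K) : val D (diff A K x) = D.R.d (val D x) :=
  (liftOp .d (fun D => D.R.d) fun _ _ => rfl).2 D x

variable (A K) in
/-- The projections to the homogeneous components. -/
noncomputable def projection (i : ℤ) : CoprodRing A K →+ CoprodRing A K :=
  (liftOp (.proj i) (fun D => D.R.proj i) fun _ _ => rfl).1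

theorem val_projection (D : Cocone A K) (i : ℤ) (x : CoprodRing A K) :
    val D (projection A K i x) = D.R.proj i (val D x) :=
  (liftOp (.proj i) (fun D => D.R.proj i) fun _ _ => rfl).2 D x

noncomputable instance : DirectSum.Decomposition (component (A := A) (K := K)) := by
  refine decompositionOfProj _ (projection A K) (fun i x hx => ?_) (fun i j hij x hx => ?_)
    (fun x => ?_)
  · exact val_injective fun D => by rw [val_projection, proj_same (mem_component.1 hx D)]
  · exact val_injective fun D => by rw [val_projection, proj_ne (mem_component.1 hx D) hij, map_zero]
  · obtain ⟨t, rfl⟩ := exists_ofExpr x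
    obtain ⟨s, hs⟩ := Cocone.exists_support_eval K t
    -- One `s` serves all cocones at once, so this sum can be compared componentwise.
    have : ofExpr t = ∑ i ∈ s, projection A K i (ofExpr t) := val_injective fun D => by
      rw [map_sum]
      simp only [val_projection, val_ofExpr]
      exact (sum_proj (hs D)).symm
    rw [this]
    refine sum_mem fun i _ => AddSubgroup.subset_closure (Set.mem_iUnion.2 ⟨i, mem_component.2 fun D => ?_⟩)
    rw [val_projection]
    exact proj_mem _ _

noncomputable instance : GradedRing (component (A := A) (K := K)) where
  one_mem := mem_component.2 fun D => by rw [map_one]; exact one_mem_gr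
  mul_mem _ _ _ _ hx hy := mem_component.2 fun D => by
    rw [map_mul]
    exact mul_mem_gr (mem_component.1 hx D) (mem_component.1 hy D)

end CoprodRing

open CoprodRing

/-- The coproduct of `A` and the models `K b`. -/
noncomputable def coprod : CDGRing.{u} where
  carrier := CoprodRing A K
  gr := component
  gr_eq_bot i hi := by
    rw [eq_bot_iff]
    intro x hx
    refine val_injective fun D => ?_
    have := mem_component.1 hx D
    rw [D.R.gr_eq_bot i hi, AddSubgroup.mem_bot] at this
    rw [this, map_zero]
  graded_comm hx hy := val_injective fun D => by
    rw [map_mul, D.R.graded_comm (mem_component.1 hx D) (mem_component.1 hy D), Units.smul_def, Units.smul_def,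
      map_zsmul, map_mul]
  odd_sq hi hx := val_injective fun D => by
    rw [map_mul, D.R.odd_sq hi (mem_component.1 hx D), map_zero]
  d := diff A K
  d_mem hx := mem_component.2 fun D => by
    rw [val_d]
    exact D.R.d_mem (mem_component.1 hx D)
  d_d x := val_injective fun D => by rw [val_d, val_d, D.R.d_d, map_zero]
  leibniz hx hy := val_injective fun D => by
    rw [val_d, map_mul, D.R.leibniz (mem_component.1 hx D) (mem_component.1 hy D), map_add, map_mul, val_d,
      Units.smul_def, Units.smul_def, map_zsmul, map_mul, val_d]

namespace coprod

variable {A K}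

/-- The universal property of the coproduct. -/
noncomputable def desc (D : Cocone A K) : Hom (coprod A K) D.R where
  toRingHom := val D
  map_mem hx := mem_component.1 hx D
  map_d := val_d D

variable (A K) in
/-- The homomorphism from `A` to the coproduct. -/
noncomputable def inl : Hom A (coprod A K) where
  toFun a := ofExpr (.of a)
  map_zero' := val_injective fun D =>
    (val_of D 0).trans (D.g.map_zero.trans (map_zero (val D)).symm)
  map_one' := val_injective fun D => (val_of D 1).trans (D.g.map_one.trans (map_one (val D)).symm)
  map_add' a b := val_injective fun D => by
    refine (val_of D _).trans ((D.g.map_add a b).trans ?_)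
    rw [← val_of, ← val_of]
    exact (map_add (val D) _ _).symm
  map_mul' a b := val_injective fun D => by
    refine (val_of D _).trans ((D.g.map_mul a b).trans ?_)
    rw [← val_of, ← val_of]
    exact (map_mul (val D) _ _).symm
  map_mem ha := mem_component.2 fun D => Set.mem_of_eq_of_mem (val_of D _) (D.g.map_mem_gr ha)
  map_d a := val_injective fun D => by
    refine (val_of D _).trans ((D.g.map_d a).trans ?_)
    rw [← val_of]
    exact (val_d D _).symm

variable (A K) in
/-- The homomorphisms from the models to the coproduct. -/
noncomputable def gen (b : I) : (K b).Family (coprod A K) where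
  w n := ofExpr (.gen b n)
  mem n := mem_component.2 fun D => by rw [val_ofExpr]; exact (D.F b).mem n
  one := val_injective fun D => by
    refine (val_ofExpr D _).trans ((D.F b).one.trans ?_)
    exact (map_one (val D)).symm
  mul m n := val_injective fun D => by
    refine (map_mul (val D) _ _).trans ?_
    refine Eq.trans ?_ (map_zsmul (val D) _ _).symm
    rw [val_ofExpr, val_ofExpr, val_ofExpr]
    exact (D.F b).mul m n
  d_w n := val_injective fun D => by
    refine (val_d D _).trans ?_
    refine Eq.trans ?_ (map_zsmul (val D) _ _).symm
    rw [val_ofExpr, val_ofExpr]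
    exact (D.F b).d_w n

variable (A K) in
/-- The coproduct as a cocone. -/
noncomputable def cocone : Cocone A K := ⟨coprod A K, inl A K, gen A K⟩

theorem desc_of (D : Cocone A K) (a : A.carrier) : desc D (inl A K a) = D.g a :=
  val_ofExpr D _

theorem desc_gen (D : Cocone A K) (b : I) (n : ℕ) :
    desc D ((gen A K b).w n) = (D.F b).w n :=
  val_ofExpr D _

/-- The coproduct is itself one of the cocones of the product, so every element is the value of an
expression in its own generators. This yields induction, hence uniqueness in the universal property.
-/
theorem eval_cocone (t : Expr A I) : (cocone A K).eval t = (ofExpr t : CoprodRing A K) := by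
  induction t with
  | of a => rfl
  | gen b n => rfl
  | add s t hs ht =>
    rw [Cocone.eval, hs, ht]
    refine val_injective fun D => (map_add (val D) _ _).trans ?_
    rw [val_ofExpr, val_ofExpr, val_ofExpr]
    rfl
  | neg s hs =>
    rw [Cocone.eval, hs]
    refine val_injective fun D => (map_neg (val D) _).trans ?_
    rw [val_ofExpr, val_ofExpr]
    rfl
  | mul s t hs ht =>
    rw [Cocone.eval, hs, ht]
    refine val_injective fun D => (map_mul (val D) _ _).trans ?_
    rw [val_ofExpr, val_ofExpr, val_ofExpr]
    rfl
  | d s hs =>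
    rw [Cocone.eval, hs]
    refine val_injective fun D => (val_d D _).trans ?_
    rw [val_ofExpr, val_ofExpr]
    rfl
  | proj i s hs =>
    rw [Cocone.eval, hs]
    refine val_injective fun D => ((desc D).map_proj i _).trans ?_
    refine Eq.trans ?_ (val_ofExpr D _).symm
    exact congrArg (D.R.proj i) (val_ofExpr D _)

/-- Induction on elements of the coproduct. -/
theorem induction {p : (coprod A K).carrier → Prop} (of : ∀ a, p (inl A K a))
    (gen : ∀ b n, p ((gen A K b).w n)) (add : ∀ x y, p x → p y → p (x + y))
    (neg : ∀ x, p x → p (-x)) (mul : ∀ x y, p x → p y → p (x * y))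
    (d : ∀ x, p x → p ((coprod A K).d x)) (proj : ∀ i x, p x → p ((coprod A K).proj i x))
    (x : (coprod A K).carrier) : p x := by
  obtain ⟨t, rfl⟩ := exists_ofExpr x
  suffices p ((cocone A K).eval t) by rwa [eval_cocone] at this
  induction t with
  | of a => exact of a
  | gen b n => exact gen b n
  | add s t hs ht => exact add _ _ hs ht
  | neg s hs => exact neg _ hs
  | mul s t hs ht => exact mul _ _ hs ht
  | d s hs => exact d _ hs
  | proj i s hs => exact proj _ _ hs

theorem hom_ext {R : CDGRing.{u}} {f g : Hom (coprod A K) R}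
    (of : ∀ a, f (inl A K a) = g (inl A K a))
    (gen : ∀ b n, f ((gen A K b).w n) = g ((gen A K b).w n))
    (x : (coprod A K).carrier) : f x = g x := by
  induction x using coprod.induction with
  | of a => exact of a
  | gen b n => exact gen b n
  | add x y hx hy => rw [Hom.map_add, Hom.map_add, hx, hy]
  | neg x hx => rw [Hom.map_neg, Hom.map_neg, hx]
  | mul x y hx hy => rw [Hom.map_mul, Hom.map_mul, hx, hy]
  | d x hx => rw [f.map_d, g.map_d, hx]
  | proj i x hx => rw [Hom.map_proj, Hom.map_proj, hx]

/-! ### Killing the models one at a time -/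

variable (A K) in
/-- The retraction to `A`. -/
noncomputable def retraction : Hom (coprod A K) A :=
  desc ⟨A, Hom.id A, fun b => (K b).augmentation A⟩

open Classical in
variable (A K) in
/-- The endomorphism of the coproduct that is the augmentation on the models `K b`, `b ∈ s`. -/
noncomputable def kill (s : Finset I) : Hom (coprod A K) (coprod A K) :=
  desc ⟨coprod A K, inl A K,
    fun b => if b ∈ s then (K b).augmentation _ else gen A K b⟩

theorem kill_of (s : Finset I) (a : A.carrier) :
    kill A K s (inl A K a) = inl A K a :=
  desc_of _ a

theorem kill_gen_mem {s : Finset I} {b : I} (hb : b ∈ s) (n : ℕ) :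
    kill A K s ((gen A K b).w n) = ((K b).augmentation (coprod A K)).w n := by
  refine (desc_gen _ b n).trans ?_
  exact congrArg (fun F : (K b).Family (coprod A K) => F.w n) (if_pos hb)

theorem kill_gen_not_mem {s : Finset I} {b : I} (hb : b ∉ s) (n : ℕ) :
    kill A K s ((gen A K b).w n) = (gen A K b).w n := by
  refine (desc_gen _ b n).trans ?_
  exact congrArg (fun F : (K b).Family (coprod A K) => F.w n) (if_neg hb)

theorem _root_.CDGRing.Hom.map_augmentation {R S : CDGRing.{u}} (f : Hom R S) (L : Model) (n : ℕ) :
    f ((L.augmentation R).w n) = (L.augmentation S).w n := by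
  simp only [augmentation]
  split_ifs
  · exact f.map_one
  · exact f.map_zero

theorem kill_insert [DecidableEq I] (b : I) (s : Finset I) (x : (coprod A K).carrier) :
    kill A K (insert b s) x = kill A K {b} (kill A K s x) := by
  refine hom_ext (f := kill A K (insert b s)) (g := (kill A K {b}).comp (kill A K s))
    (fun a => ?_) (fun c n => ?_) x
  · rw [Hom.comp_apply, kill_of, kill_of, kill_of]
  · rw [Hom.comp_apply]
    by_cases hc : c ∈ s
    · rw [kill_gen_mem hc, kill_gen_mem (Finset.mem_insert_of_mem hc), Hom.map_augmentation]
    · rw [kill_gen_not_mem hc]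
      by_cases hb : c = b
      · subst hb
        rw [kill_gen_mem (Finset.mem_insert_self _ _), kill_gen_mem (Finset.mem_singleton_self _)]
      · rw [kill_gen_not_mem (by simp [hb, hc]), kill_gen_not_mem (by simp [hb])]

/-- An expression mentions finitely many generators, and once their models are killed only its image
in `A` remains. -/
theorem exists_kill (x : (coprod A K).carrier) :
    ∃ s, kill A K s x = inl A K (retraction A K x) := by
  classical
  -- Asking for all larger sets lets the sets of two subexpressions be merged into their union.
  suffices h : ∃ s, ∀ t, s ⊆ t → kill A K t x = inl A K (retraction A K x) from
    h.imp fun s hs => hs s subset_rfl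
  induction x using coprod.induction with
  | of a =>
    refine ⟨∅, fun t _ => ?_⟩
    rw [kill_of, retraction, desc_of]
    rfl
  | gen b n =>
    refine ⟨{b}, fun t ht => ?_⟩
    rw [kill_gen_mem (Finset.singleton_subset_iff.1 ht), retraction, desc_gen]
    exact (Hom.map_augmentation _ _ _).symm
  | add x y hx hy =>
    obtain ⟨s, hs⟩ := hx
    obtain ⟨s', hs'⟩ := hy
    refine ⟨s ∪ s', fun t ht => ?_⟩
    rw [Hom.map_add, Hom.map_add, Hom.map_add, hs t (Finset.union_subset_left ht),
      hs' t (Finset.union_subset_right ht)]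
  | neg x hx =>
    obtain ⟨s, hs⟩ := hx
    exact ⟨s, fun t ht => by rw [Hom.map_neg, Hom.map_neg, Hom.map_neg, hs t ht]⟩
  | mul x y hx hy =>
    obtain ⟨s, hs⟩ := hx
    obtain ⟨s', hs'⟩ := hy
    refine ⟨s ∪ s', fun t ht => ?_⟩
    rw [Hom.map_mul, Hom.map_mul, Hom.map_mul, hs t (Finset.union_subset_left ht),
      hs' t (Finset.union_subset_right ht)]
  | d x hx =>
    obtain ⟨s, hs⟩ := hx
    refine ⟨s, fun t ht => ?_⟩
    rw [(kill A K t).map_d, hs t ht, (retraction A K).map_d, (inl A K).map_d]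
  | proj i x hx =>
    obtain ⟨s, hs⟩ := hx
    refine ⟨s, fun t ht => ?_⟩
    rw [Hom.map_proj, hs t ht, Hom.map_proj, Hom.map_proj]

open Classical in
/-- The homomorphism that splits off the model `K b`. -/
noncomputable def split (b : I) : Hom (coprod A K) (extend (K b) (coprod A K)) :=
  -- The coefficients stay the full coproduct, so no coproduct over `I \ {b}` is needed; their own
  -- copy of `K b` is simply not hit by the generators.
  desc ⟨extend (K b) (coprod A K), (incl (K b) (coprod A K)).comp (inl A K),
    fun c => if h : c = b then h ▸ tautFamily (K b) (coprod A K)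
      else (gen A K c).map (incl (K b) (coprod A K))⟩

theorem split_of (b : I) (a : A.carrier) :
    split b (inl A K a) = incl (K b) (coprod A K) (inl A K a) :=
  desc_of _ a

theorem split_gen_self (b : I) (n : ℕ) :
    split b ((gen A K b).w n) = (tautFamily (K b) (coprod A K)).w n := by
  refine (desc_gen _ b n).trans ?_
  simp

theorem split_gen_ne {b c : I} (h : c ≠ b) (n : ℕ) :
    split b ((gen A K c).w n) = incl (K b) (coprod A K) ((gen A K c).w n) := by
  refine (desc_gen _ c n).trans ?_
  simp only [dif_neg h]
  rfl

/-- Sending the split-off copy of `K b` back to its place undoes `split`. Sending it to its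
augmentation instead kills `K b`, so the homotopy on the extension compares the two. -/
theorem lift_split (b : I) (x : (coprod A K).carrier) :
    Model.lift (Hom.id _) (gen A K b) (split b x) = x := by
  refine hom_ext (f := (Model.lift (Hom.id _) (gen A K b)).comp (split b))
    (g := Hom.id _) (fun a => ?_) (fun c n => ?_) x
  · rw [Hom.comp_apply, split_of]
    exact lift_incl _ _ _
  · rw [Hom.comp_apply]
    by_cases h : c = b
    · subst h
      rw [split_gen_self]
      exact lift_taut _ _ _
    · rw [split_gen_ne h]
      exact lift_incl _ _ _

theorem lift_augmentation_split (b : I) (x : (coprod A K).carrier) :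
    Model.lift (Hom.id _) ((K b).augmentation _) (split b x) = kill A K {b} x := by
  refine hom_ext (f := (Model.lift (Hom.id _) ((K b).augmentation _)).comp (split b))
    (g := kill A K {b}) (fun a => ?_) (fun c n => ?_) x
  · rw [Hom.comp_apply, split_of, kill_of]
    exact lift_incl _ _ _
  · rw [Hom.comp_apply]
    by_cases h : c = b
    · subst h
      rw [split_gen_self, kill_gen_mem (Finset.mem_singleton_self _)]
      exact lift_taut _ _ _
    · rw [split_gen_ne h, kill_gen_not_mem (by simp [h])]
      exact lift_incl _ _ _

/-- The homotopy formula on `K b ⊗ coprod`, applied to `split b x` and pushed back along `ψ`, reads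
`d (ψ (h (split b x))) = x - kill {b} x`, because `d x = 0`. -/
theorem sub_kill_singleton (b : I) {i : ℤ} {x : (coprod A K).carrier}
    (hx : x ∈ (coprod A K).cocycles i) : x - kill A K {b} x ∈ (coprod A K).coboundaries i := by
  set ψ := Model.lift (Hom.id _) (gen A K b)
  refine ⟨ψ (extendH (K b) _ (split b x)),
    ψ.map_mem_gr (extH_mem ((split b).map_mem_gr hx.1)), ?_⟩
  have h := congrArg ψ (extH_homotopy (split b x))
  have h0 : (coprod A K).d x = 0 := hx.2
  rw [← (split b).map_d, h0, Hom.map_zero, map_zero, add_zero, Hom.map_sub, lift_incl, lift_split,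
    lift_augmentation_split, ψ.map_d] at h
  exact h

theorem sub_kill (s : Finset I) {i : ℤ} {x : (coprod A K).carrier}
    (hx : x ∈ (coprod A K).cocycles i) : x - kill A K s x ∈ (coprod A K).coboundaries i := by
  classical
  induction s using Finset.induction_on with
  | empty =>
    have : kill A K ∅ x = x :=
      hom_ext (f := kill A K ∅) (g := Hom.id _) (kill_of ∅)
        (fun b n => kill_gen_not_mem (Finset.notMem_empty b) n) x
    rw [this, sub_self]
    exact zero_mem _
  | insert b s _ ih =>
    rw [kill_insert, ← sub_add_sub_cancel _ (kill A K s x)]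
    exact add_mem ih (sub_kill_singleton b ((kill A K s).map_mem_cocycles hx))

theorem sub_retraction {i : ℤ} {x : (coprod A K).carrier} (hx : x ∈ (coprod A K).cocycles i) :
    x - inl A K (retraction A K x) ∈ (coprod A K).coboundaries i := by
  obtain ⟨s, hs⟩ := exists_kill x
  rw [← hs]
  exact sub_kill s hx

theorem retraction_of (a : A.carrier) : retraction A K (inl A K a) = a :=
  desc_of _ a

end coprod

end CDGRing

/-! ### The two concrete models and their maps to a CDG ring -/

namespace CDGRing

namespace Model

/-- The degree of `u ^ p * v ^ e` at the index `2 * p + e`, for `u` and `v` of degrees `a` and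
`b`. -/
def wordDeg (a b : ℤ) (n : ℕ) : ℤ := ((n / 2 : ℕ) : ℤ) * a + ((n % 2 : ℕ) : ℤ) * b

theorem wordDeg_zero (a b : ℤ) : wordDeg a b 0 = 0 := by simp [wordDeg]

theorem wordDeg_even (a b : ℤ) {n : ℕ} (h : n % 2 = 0) : wordDeg a b n = (n / 2 : ℕ) * a := by
  simp [wordDeg, h]

theorem wordDeg_odd (a b : ℤ) {n : ℕ} (h : n % 2 = 1) : wordDeg a b n = (n / 2 : ℕ) * a + b := by
  simp [wordDeg, h]

theorem wordDeg_nonpos {a b : ℤ} (ha : a ≤ 0) (hb : b ≤ 0) (n : ℕ) : wordDeg a b n ≤ 0 :=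
  add_nonpos (mul_nonpos_of_nonneg_of_nonpos (Int.natCast_nonneg _) ha)
    (mul_nonpos_of_nonneg_of_nonpos (Int.natCast_nonneg _) hb)

theorem wordDeg_parity {a b : ℤ} (ha : Even a) (hb : Odd b) (n : ℕ) :
    (wordDeg a b n).negOnePow = (n : ℤ).negOnePow := by
  rcases Nat.mod_two_eq_zero_or_one n with h | h
  · rw [wordDeg_even _ _ h, Int.negOnePow_even _ (ha.mul_left _), Int.negOnePow_even]
    exact_mod_cast Nat.even_iff.2 h
  · rw [wordDeg_odd _ _ h, Int.negOnePow_odd _ ((ha.mul_left _).add_odd hb), Int.negOnePow_odd]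
    exact_mod_cast Nat.odd_iff.2 h

/-- The structure constants of the multiplication of the elements `u p * v ^ e` at the indices
`2 * p + e`, where `u p * u q = c p q • u (p + q)` and `v * v = 0`. -/
def twist (c : ℕ → ℕ → ℤ) (m n : ℕ) : ℤ :=
  if m % 2 = 1 ∧ n % 2 = 1 then 0 else c (m / 2) (n / 2)

theorem add_div_two {m n : ℕ} (h : ¬(m % 2 = 1 ∧ n % 2 = 1)) : (m + n) / 2 = m / 2 + n / 2 := by
  omega

theorem twist_zero_left {c : ℕ → ℕ → ℤ} (hc : ∀ n, c 0 n = 1) (n : ℕ) : twist c 0 n = 1 := by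
  simp [twist, hc]

theorem twist_zero_right {c : ℕ → ℕ → ℤ} (hc : ∀ n, c n 0 = 1) (n : ℕ) : twist c n 0 = 1 := by
  simp [twist, hc]

/-- If at least two of the indices are odd, both sides vanish. Otherwise halving is additive and the
identity is that of `c`. -/
theorem twist_assoc {c : ℕ → ℕ → ℤ}
    (hc : ∀ m n p, c m n * c (m + n) p = c n p * c m (n + p)) (m n p : ℕ) :
    twist c m n * twist c (m + n) p = twist c n p * twist c m (n + p) := by
  unfold twist
  split_ifs with h1 h2 h3 h4 h5 h6
  all_goals first
    | (simp only [zero_mul, mul_zero]; done)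
    | (exfalso; omega)
    | (rw [add_div_two h1, add_div_two (m := n) (n := p) (by assumption)]; exact hc _ _ _)

theorem twist_comm {c : ℕ → ℕ → ℤ} (hc : ∀ m n, c m n = c n m) (m n : ℕ) :
    twist c m n = twist c n m := by
  rw [twist, twist, hc]
  exact if_congr and_comm rfl rfl

theorem twist_odd (c : ℕ → ℕ → ℤ) (m n : ℕ) (hm : Odd m) (hn : Odd n) : twist c m n = 0 :=
  if_pos ⟨Nat.odd_iff.1 hm, Nat.odd_iff.1 hn⟩

theorem twist_wordDeg (c : ℕ → ℕ → ℤ) (a b : ℤ) (m n : ℕ) (h : twist c m n ≠ 0) :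
    wordDeg a b (m + n) = wordDeg a b m + wordDeg a b n := by
  have h' : ¬(m % 2 = 1 ∧ n % 2 = 1) := fun h' => h (if_pos h')
  have h2 : (m + n) % 2 = m % 2 + n % 2 := by omega
  rw [wordDeg, wordDeg, wordDeg, add_div_two h', h2]
  push_cast
  ring

/-- The elements `u p * v ^ e` at the indices `2 * p + e`. -/
def word {R : CDGRing.{u}} (f : ℕ → R.carrier) (v : R.carrier) (n : ℕ) : R.carrier :=
  if n % 2 = 1 then f (n / 2) * v else f (n / 2)

section word

variable {R : CDGRing.{u}} {f : ℕ → R.carrier} {v : R.carrier}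

theorem word_mem {a b : ℤ} (hf : ∀ n : ℕ, f n ∈ R.gr (n * a)) (hv : v ∈ R.gr b) (n : ℕ) :
    word f v n ∈ R.gr (wordDeg a b n) := by
  rcases Nat.mod_two_eq_zero_or_one n with h | h
  · rw [word, if_neg (by omega), wordDeg_even _ _ h]
    exact hf _
  · rw [word, if_pos h, wordDeg_odd _ _ h]
    exact mul_mem_gr (hf _) hv

theorem word_mul {c : ℕ → ℕ → ℤ} (hf : ∀ m n, f m * f n = c m n • f (m + n)) (hv : v * v = 0)
    (hfv : ∀ n, v * f n = f n * v) (m n : ℕ) :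
    word f v m * word f v n = twist c m n • word f v (m + n) := by
  by_cases h : m % 2 = 1 ∧ n % 2 = 1
  · rw [word, word, if_pos h.1, if_pos h.2, twist, if_pos h, zero_smul, mul_assoc,
      ← mul_assoc v, hfv, mul_assoc (f (n / 2)), hv, mul_zero, mul_zero]
  · rw [twist, if_neg h, word, word, word, add_div_two h]
    split_ifs
    all_goals first
      | (exfalso; omega)
      | (simp only [hf])
      | (rw [← smul_mul_assoc, ← hf, mul_assoc, mul_assoc, hfv])
      | (rw [← smul_mul_assoc, ← hf, mul_assoc])

theorem commute_of_even {a b : ℤ} (ha : Even a) (hf : ∀ n : ℕ, f n ∈ R.gr (n * a))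
    (hv : v ∈ R.gr b) (n : ℕ) : v * f n = f n * v := by
  rw [R.graded_comm (hf n) hv, Int.negOnePow_even _ ((ha.mul_left _).mul_right _), one_smul]

end word

/-- The model with a generator `x` of odd degree `i`: it is spanned by the elements
`(d x) ^ p * x ^ e`. -/
def oddModel (i : ℤ) (hi : Odd i) (hi' : i ≤ -1) : Model where
  deg := wordDeg (i + 1) i
  c := twist fun _ _ => 1
  k n := if n % 2 = 1 then 1 else 0
  -- The differential takes `(d x)^p x` (index `2p + 1`) to `(d x)^(p+1)` (index `2p + 2`), and the
  -- homotopy goes back. Since `l 0 = 0`, the truncated value `ρ 0 = 0` plays no role.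
  τ n := n + 1
  l n := if n % 2 = 0 ∧ n ≠ 0 then 1 else 0
  ρ n := n - 1
  deg_zero := wordDeg_zero _ _
  deg_nonpos := wordDeg_nonpos (by omega) (by omega)
  deg_parity := wordDeg_parity hi.add_one hi
  c_zero_left := twist_zero_left fun _ => rfl
  c_zero_right := twist_zero_right fun _ => rfl
  c_assoc := twist_assoc fun _ _ _ => rfl
  c_comm := twist_comm fun _ _ => rfl
  c_odd := twist_odd _
  deg_add := twist_wordDeg _ _ _
  deg_τ n h := by
    have hn : n % 2 = 1 := by by_contra h'; exact h (if_neg h')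
    rw [wordDeg_odd _ _ hn, wordDeg_even _ _ (by omega), show (n + 1) / 2 = n / 2 + 1 by omega]
    push_cast
    ring
  τ_ne_zero n _ := by omega
  k_mul_k n := by split_ifs <;> first | rfl | omega
  leibniz m n := by
    rw [show m + 1 + n = m + n + 1 by ring, ← add_assoc m n 1, ← Finsupp.single_add]
    congr 1
    unfold twist
    rcases Nat.mod_two_eq_zero_or_one m with hm | hm
    · rw [Int.negOnePow_even _ (by exact_mod_cast Nat.even_iff.2 hm)]
      split_ifs <;> first | (exfalso; omega) | simp
    · rw [Int.negOnePow_odd _ (by exact_mod_cast Nat.odd_iff.2 hm)]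
      split_ifs <;> first | (exfalso; omega) | simp
  deg_ρ n h := by
    have hn : n % 2 = 0 ∧ n ≠ 0 := by by_contra h'; exact h (if_neg h')
    rw [wordDeg_even _ _ hn.1, wordDeg_odd _ _ (by omega),
      show n / 2 = (n - 1) / 2 + 1 by omega]
    push_cast
    ring
  contraction n := by
    rcases eq_or_ne n 0 with rfl | h0
    · simp
    · rw [if_neg h0, Nat.sub_add_cancel (Nat.pos_of_ne_zero h0), Nat.add_sub_cancel,
        ← Finsupp.single_add]
      congr 1
      split_ifs <;> first | (exfalso; omega) | simp

/-- The model with a generator `x` of even degree `i`: it is spanned by the elements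
`x ^ [p] * (d x) ^ e`, where `x ^ [p]` are the divided powers. -/
def evenModel (i : ℤ) (hi : Even i) (hi' : i ≤ -1) : Model where
  deg := wordDeg i (i + 1)
  c := twist fun p q => ((p + q).choose q : ℕ)
  k n := if n % 2 = 0 ∧ n ≠ 0 then 1 else 0
  -- The differential takes `x^[p]` (index `2p`, `p ≥ 1`) to `x^[p-1] d x` (index `2p - 1`), and the
  -- homotopy goes back. The unit coefficients make this a contraction over `ℤ`.
  τ n := n - 1
  l n := if n % 2 = 1 then 1 else 0
  ρ n := n + 1
  deg_zero := wordDeg_zero _ _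
  deg_nonpos := wordDeg_nonpos (by omega) (by omega)
  deg_parity := wordDeg_parity hi hi.add_one
  c_zero_left := twist_zero_left fun n => by simp
  c_zero_right := twist_zero_right fun n => by simp
  c_assoc := twist_assoc fun m n p => by
    have h := Nat.choose_mul (n := m + n + p) (k := n + p) (s := p) (by omega)
    rw [show m + n + p - p = m + n by omega, show n + p - p = n by omega] at h
    rw [← add_assoc m n p]
    norm_cast
    rw [mul_comm, ← h, mul_comm]
  c_comm := twist_comm fun m n => by rw [add_comm m n, Nat.choose_symm_add]
  c_odd := twist_odd _
  deg_add := twist_wordDeg _ _ _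
  deg_τ n h := by
    have hn : n % 2 = 0 ∧ n ≠ 0 := by by_contra h'; exact h (if_neg h')
    rw [wordDeg_even _ _ hn.1, wordDeg_odd _ _ (by omega),
      show n / 2 = (n - 1) / 2 + 1 by omega]
    push_cast
    ring
  τ_ne_zero n h := by
    have hn : n % 2 = 0 ∧ n ≠ 0 := by by_contra h'; exact h (if_neg h')
    omega
  k_mul_k n := by split_ifs <;> first | rfl | omega
  leibniz m n := by
    unfold twist
    by_cases h : m % 2 = 0 ∧ n % 2 = 0
    · obtain ⟨p, rfl⟩ := Nat.dvd_of_mod_eq_zero h.1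
      obtain ⟨q, rfl⟩ := Nat.dvd_of_mod_eq_zero h.2
      rw [Int.negOnePow_even _ (by simp)]
      rcases p with _ | p
      · rcases q with _ | q
        · simp
        · simp
      · rcases q with _ | q
        · simp
        · have e1 : 2 * (p + 1) + 2 * (q + 1) - 1 = 2 * (p + q + 1) + 1 := by omega
          have e2 : 2 * (p + 1) - 1 + 2 * (q + 1) = 2 * (p + q + 1) + 1 := by omega
          have e3 : 2 * (p + 1) + (2 * (q + 1) - 1) = 2 * (p + q + 1) + 1 := by omega
          have d1 : (2 * (p + 1)) / 2 = p + 1 := by omega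
          have d2 : (2 * (q + 1)) / 2 = q + 1 := by omega
          have d3 : (2 * (p + 1) - 1) / 2 = p := by omega
          have d4 : (2 * (q + 1) - 1) / 2 = q := by omega
          rw [if_neg (by omega), if_pos (by omega), if_pos (by omega), if_neg (by omega),
            if_pos (by omega), if_neg (by omega), e1, e2, e3, d1, d2, d3, d4,
            ← Finsupp.single_add]
          congr 1
          beta_reduce
          -- For two divided powers of positive order, the Leibniz rule is Pascal's rule.
          rw [show p + (q + 1) = p + 1 + q by ring, ← add_assoc (p + 1) q 1,
            Nat.choose_succ_succ]
          push_cast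
          ring
    -- With an odd index present all three terms vanish: `d` kills odd indices, and two odd indices
    -- multiply to zero.
    · have z1 : ∀ x y : ℤ, (if m % 2 = 1 ∧ n % 2 = 1 then 0 else x) *
          (if (m + n) % 2 = 0 ∧ m + n ≠ 0 then y else 0) = 0 := fun x y => by
        split_ifs <;> first | (exfalso; omega) | simp
      have z2 : ∀ x y : ℤ, (if m % 2 = 0 ∧ m ≠ 0 then x else 0) *
          (if (m - 1) % 2 = 1 ∧ n % 2 = 1 then 0 else y) = 0 := fun x y => by
        split_ifs <;> first | (exfalso; omega) | simp
      have z3 : ∀ x y : ℤ, (if n % 2 = 0 ∧ n ≠ 0 then x else 0) *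
          (if m % 2 = 1 ∧ (n - 1) % 2 = 1 then 0 else y) = 0 := fun x y => by
        split_ifs <;> first | (exfalso; omega) | simp
      rw [z1, z2, z3]
      simp
  deg_ρ n h := by
    have hn : n % 2 = 1 := by by_contra h'; exact h (if_neg h')
    rw [wordDeg_odd _ _ hn, wordDeg_even _ _ (by omega), show (n + 1) / 2 = n / 2 + 1 by omega]
    push_cast
    ring
  contraction n := by
    rcases eq_or_ne n 0 with rfl | h0
    · simp
    · rw [if_neg h0, Nat.sub_add_cancel (Nat.pos_of_ne_zero h0), Nat.add_sub_cancel,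
        ← Finsupp.single_add]
      congr 1
      split_ifs <;> first | (exfalso; omega) | simp

/-- The homomorphism from `oddModel` that sends `x` to a given element. -/
def oddFamily {R : CDGRing.{u}} {i : ℤ} (hi : Odd i) (hi' : i ≤ -1) {x : R.carrier}
    (hx : x ∈ R.gr i) : (oddModel i hi hi').Family R :=
  have hf : ∀ n : ℕ, R.d x ^ n ∈ R.gr (n * (i + 1)) := fun n => by
    simpa using SetLike.pow_mem_graded n (R.d_mem hx)
  have hd : ∀ n : ℕ, R.d (R.d x ^ n) = 0 := fun n => by
    induction n with
    | zero => rw [pow_zero, d_one]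
    | succ n ih => rw [pow_succ, leibniz', ih, R.d_d, mul_zero, zero_mul, add_zero]
  { w := word (fun n => R.d x ^ n) x
    mem := word_mem hf hx
    one := by simp [word]
    mul := word_mul (c := fun _ _ => 1) (fun m n => by rw [one_smul, pow_add]) (R.odd_sq hi hx)
      (commute_of_even hi.add_one hf hx)
    d_w := fun n => by
      change _ = (if n % 2 = 1 then (1 : ℤ) else 0) • word (fun n => R.d x ^ n) x (n + 1)
      rcases Nat.mod_two_eq_zero_or_one n with h | h
      · rw [word, if_neg (by omega), if_neg (by omega), hd, zero_smul]
      · rw [word, if_pos h, if_pos h, word, if_neg (by omega), leibniz', hd, one_smul, zero_mul,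
          zero_add, invol_of_mem (hf _), Int.negOnePow_even _ (hi.add_one.mul_left _), one_smul,
          ← pow_succ, show (n + 1) / 2 = n / 2 + 1 by omega] }

/-- The homomorphism from `evenModel` that sends `x` to a given element with divided powers. -/
def evenFamily {R : CDGRing.{u}} (P : PDStructure R) {i : ℤ} (hi : Even i) (hi' : i ≤ -1)
    (hi2 : i ≤ -2) (x : R.gr i) : (evenModel i hi hi').Family R :=
  have hf : ∀ n : ℕ, (P.γ n hi hi2 x : R.carrier) ∈ R.gr (n * i) := fun n => (P.γ n hi hi2 x).2
  have hdd : R.d x * R.d x = 0 := R.odd_sq hi.add_one (R.d_mem x.2)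
  have hc := commute_of_even (f := fun n => (P.γ n hi hi2 x : R.carrier)) hi hf (R.d_mem x.2)
  { w := word (fun n => P.γ n hi hi2 x) (R.d x)
    mem := word_mem hf (R.d_mem x.2)
    one := by simp [word, P.γ_zero]
    mul := word_mul (c := fun p q => ((p + q).choose q : ℕ)) (fun m n => by rw [P.γ_mul, natCast_zsmul]) hdd hc
    d_w := fun n => by
      change _ = (if n % 2 = 0 ∧ n ≠ 0 then (1 : ℤ) else 0) •
        word (fun n => (P.γ n hi hi2 x : R.carrier)) (R.d x) (n - 1)
      rcases eq_or_ne n 0 with rfl | h0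
      · simp [word, P.γ_zero, d_one]
      rcases Nat.mod_two_eq_zero_or_one n with h | h
      · rw [word, if_neg (by omega), if_pos ⟨h, h0⟩, P.d_γ _ _ _ _ (by omega), one_smul, word,
          if_pos (by omega), hc, show n / 2 - 1 = (n - 1) / 2 by omega]
      · rw [word, if_pos h, if_neg (by omega), zero_smul, leibniz', R.d_d, mul_zero, add_zero]
        rcases Nat.eq_zero_or_pos (n / 2) with h2 | h2
        · rw [h2, P.γ_zero, d_one, zero_mul]
        -- The differential of `x^[p] d x` contains `d x` twice, and `d x` is odd.
        · rw [P.d_γ _ _ _ _ h2, mul_assoc, ← hc, ← mul_assoc, hdd, zero_mul] }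

open Classical in
/-- The model with one generator of degree `i`. -/
noncomputable def ofDegree (i : ℤ) (hi : i ≤ -1) : Model :=
  if h : Odd i then oddModel i h hi else evenModel i (Int.not_odd_iff_even.1 h) hi

/-- The only place where divided powers in the target enter, and only for even degrees. The
generator `x` has index 1 in the odd model and index 2, as `x^[1]`, in the even one. -/
theorem exists_family {R : CDGRing.{u}} (P : PDStructure R) {i : ℤ} (hi : i ≤ -1) (x : R.gr i) :
    ∃ (F : (ofDegree i hi).Family R) (n : ℕ), F.w n = x := by
  by_cases h : Odd i
  · rw [ofDegree, dif_pos h]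
    exact ⟨oddFamily h hi x.2, 1, by simp [oddFamily, word]⟩
  · rw [ofDegree, dif_neg h]
    have h' := Int.not_odd_iff_even.1 h
    have h2 : i ≤ -2 := by
      rcases h' with ⟨r, rfl⟩
      omega
    exact ⟨evenFamily P h' hi h2 x, 2, by simp [evenFamily, word, P.γ_one]⟩

end Model

/-! ### Quasi-isomorphisms in terms of elements, and the conclusion -/

namespace Hom

variable {A B : CDGRing.{u}}

theorem isQuasiIso_iff (f : Hom A B) : f.IsQuasiIso ↔
    (∀ i, ∀ a ∈ A.cocycles i, f a ∈ B.coboundaries i → a ∈ A.coboundaries i) ∧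
      ∀ i, ∀ b ∈ B.cocycles i, ∃ a ∈ A.cocycles i, b - f a ∈ B.coboundaries i := by
  rw [IsQuasiIso, ← forall_and]
  refine forall_congr' fun i => and_congr ?_ ?_
  · rw [injective_iff_map_eq_zero]
    constructor
    · intro h a ha hfa
      exact (QuotientAddGroup.eq_zero_iff (⟨a, ha⟩ : A.cocycles i)).1
        (h _ ((QuotientAddGroup.eq_zero_iff (f.cocyclesMap i ⟨a, ha⟩)).2 hfa))
    · intro h a ha
      obtain ⟨a, rfl⟩ := QuotientAddGroup.mk_surjective a
      exact (QuotientAddGroup.eq_zero_iff a).2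
        (h a a.2 ((QuotientAddGroup.eq_zero_iff (f.cocyclesMap i a)).1 ha))
  · constructor
    · intro h b hb
      obtain ⟨a, ha⟩ := h (QuotientAddGroup.mk ⟨b, hb⟩)
      obtain ⟨a, rfl⟩ := QuotientAddGroup.mk_surjective a
      have := (QuotientAddGroup.eq (s := (B.coboundaries i).addSubgroupOf (B.cocycles i))).1 ha
      rw [neg_add_eq_sub] at this
      exact ⟨a, a.2, this⟩
    · intro h b
      obtain ⟨b, rfl⟩ := QuotientAddGroup.mk_surjective b
      obtain ⟨a, ha, hab⟩ := h b b.2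
      refine ⟨QuotientAddGroup.mk ⟨a, ha⟩, QuotientAddGroup.eq.2 ?_⟩
      rw [neg_add_eq_sub]
      exact hab

theorem surjective_of_gr (f : Hom A B) (h : ∀ i, ∀ b ∈ B.gr i, ∃ a, f a = b) :
    Function.Surjective f := by
  intro b
  induction b using hom_induction with
  | zero => exact ⟨0, f.map_zero⟩
  | hom i b hb => exact h i b hb
  | add b c hb hc =>
    obtain ⟨a, rfl⟩ := hb
    obtain ⟨a', rfl⟩ := hc
    exact ⟨a + a', f.map_add a a'⟩

end Hom

end CDGRing

open CDGRing coprod in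
theorem theorem1 (A B : CDGRing.{u}) (f : CDGRing.Hom A B) (hf : f.IsQuasiIso)
    (hB : Nonempty (CDGRing.PDStructure B)) :
    ∃ (B' : CDGRing.{u}) (e : CDGRing.Hom A B') (p : CDGRing.Hom B' A)
      (f' : CDGRing.Hom B' B),
      p.comp e = CDGRing.Hom.id A ∧ f'.comp e = f ∧
        Function.Surjective f' ∧ f'.IsQuasiIso := by
  obtain ⟨P⟩ := hB
  rw [Hom.isQuasiIso_iff] at hf
  choose F m hF using fun b : Σ i : {i : ℤ // i ≤ -1}, B.gr i =>
    Model.exists_family P b.1.2 b.2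
  set K := fun b : Σ i : {i : ℤ // i ≤ -1}, B.gr i => Model.ofDegree b.1.1 b.1.2
  set f' : Hom (coprod A K) B := desc ⟨B, f, F⟩
  have hf' : ∀ a, f' (inl A K a) = f a := desc_of _
  have neg : ∀ i, i ≤ -1 → ∀ b ∈ B.gr i, ∃ a, f' a = b := fun i hi b hb =>
    ⟨(gen A K ⟨⟨i, hi⟩, b, hb⟩).w (m ⟨⟨i, hi⟩, b, hb⟩), (desc_gen _ _ _).trans (hF _)⟩
  refine ⟨coprod A K, inl A K, retraction A K, f', Hom.ext retraction_of, Hom.ext hf',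
    f'.surjective_of_gr fun i b hb => ?_, f'.isQuasiIso_iff.2 ⟨fun i z hz hfz => ?_,
    fun i b hb => ?_⟩⟩
  · rcases lt_trichotomy i 0 with hi | rfl | hi
    · exact neg i (by omega) b hb
    -- Since `B^1 = 0`, an element of degree 0 is a cocycle. Hence it is `f a` up to some `d c` with
    -- `c` of degree -1, and `c` is already in the image.
    · have hdb : B.d b = 0 := by
        have := B.d_mem hb
        rwa [B.gr_eq_bot _ (by omega), AddSubgroup.mem_bot] at this
      obtain ⟨a, -, c, hc, hac⟩ := hf.2 0 b ⟨hb, hdb⟩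
      obtain ⟨c', rfl⟩ := neg _ (by omega) c hc
      refine ⟨(coprod A K).d c' + inl A K a, ?_⟩
      rw [Hom.map_add, hf', f'.map_d, hac, sub_add_cancel]
    · rw [B.gr_eq_bot i hi, AddSubgroup.mem_bot] at hb
      exact ⟨0, by rw [Hom.map_zero, hb]⟩
  -- As `z` and `e (p z)` are cohomologous, `f (p z)` is a coboundary. Injectivity of `H^i(f)` makes
  -- `p z` one, and therefore `z`.
  · have h := sub_retraction hz
    have h2 := f'.map_mem_coboundaries h
    rw [Hom.map_sub, hf'] at h2
    have h3 := hf.1 i _ ((retraction A K).map_mem_cocycles hz)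
      (by simpa using sub_mem hfz h2)
    simpa using add_mem h ((inl A K).map_mem_coboundaries h3)
  -- Surjectivity on cohomology is inherited from `f`, which factors through `f'`.
  · obtain ⟨a, ha, hab⟩ := hf.2 i b hb
    exact ⟨inl A K a, (inl A K).map_mem_cocycles ha, by rwa [hf']⟩
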